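/- For $x\in\mathbb R^3$ put $\langle x\rangle=(1+|x|^2)^{1/2}$, and let $w(x)=\langle x\rangle^{-\sigma}$ with $\sigma>4$. Let $B=(B_k)_{k\ge 0}$ be a sequence of real numbers. For $0<\delta\le 1$ and $\omega_0\in S^2$, call a real-valued smooth function $\chi$ on $S^2$ a cut-off adapted to the $\delta$-cap about $\omega_0$ if $\chi(\omega)=0$ whenever $|\omega-\omega_0|>\delta$ and if, for every $k\ge0$ and every $\omega\in S^2$, the $k$-th derivative at $\omega$ of the function $x\mapsto\chi(x/|x|)$ on $\mathbb R^3\setminus\{0\}$ has norm at most $B_k\delta^{-k}$. For $\lambda>0$ define, for $x\ne y$ in $\mathbb R^3$, the kernels \[ \tilde Q_\lambda(x,y)=w(x)\,\frac{e^{i\lambda|x-y|}}{|x-y|}\,\chi\Big(\frac{x-y}{|x-y|}\Big)\,w(y),\qquad Q_\lambda(x,y)=w(x)\,\nabla_x\Big[\frac{e^{i\lambda|x-y|}}{|x-y|}\,\chi\Big(\frac{x-y}{|x-y|}\Big)\Big]\,w(y). \] Then there is a constant $C_0>0$, depending only on $\sigma$ and $B$, such that for all $0<\delta\le1$, all $\lambda>\delta^{-2}$,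 all $\omega_0\in S^2$ and all cut-offs $\chi$ adapted to the $\delta$-cap about $\omega_0$, the following holds. For every $f\in L^2(\mathbb R^3;\mathbb C)$ the integrals $\int\tilde Q_\lambda(x,y)f(y)\,dy$ and $\int Q_\lambda(x,y)f(y)\,dy$ converge absolutely for almost every $x$, and the integral operators $\tilde Q_\lambda:L^2(\mathbb R^3;\mathbb C)\to L^2(\mathbb R^3;\mathbb C)$ and $Q_\lambda:L^2(\mathbb R^3;\mathbb C)\to L^2(\mathbb R^3;\mathbb C^3)$ so defined satisfy \[ \|\tilde Q_\lambda\|_{2\to2}\le C_0\,\lambda^{-1},\qquad \|Q_\lambda\|_{2\to2}\le C_0 . \] In particular $C_0$ does not depend on $\delta$ (nor on $\lambda$, $\omega_0$ or the individual cut-off). -/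

import Mathlib

open MeasureTheory

noncomputable section

/-- Euclidean three-space. -/
abbrev E3 : Type := EuclideanSpace ℝ (Fin 3)

/-- The weight `w(x) = ⟨x⟩^{-σ}`, where `⟨x⟩ = (1 + |x|²)^{1/2}`. -/
def weight (σ : ℝ) (x : E3) : ℝ := Real.sqrt (1 + ‖x‖ ^ 2) ^ (-σ)

/-- The radial projection `x ↦ x / |x|` onto the unit sphere. -/
def direction (x : E3) : E3 := ‖x‖⁻¹ • x

/-- `χ` is a smooth cut-off on the unit sphere adapted to the cap of radius `δ` about `ω₀`:
it is smooth, supported in that cap, and its derivatives of order `k` are at most `B k * δ ^ (-k)`.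
Smoothness and derivatives on the sphere are those of the extension `x ↦ χ (x / |x|)`, which is
homogeneous of degree zero; only the values of `χ` on the unit sphere matter. -/
structure IsCapCutoff (B : ℕ → ℝ) (δ : ℝ) (ω₀ : E3) (χ : E3 → ℝ) : Prop where
  center_mem : ‖ω₀‖ = 1
  smooth : ContDiffOn ℝ (⊤ : ℕ∞) (fun x => χ (direction x)) {0}ᶜ
  support_subset : ∀ ω : E3, ‖ω‖ = 1 → χ ω ≠ 0 → dist ω ω₀ ≤ δ
  deriv_bound : ∀ (k : ℕ) (ω : E3), ‖ω‖ = 1 →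
    ‖iteratedFDeriv ℝ k (fun x => χ (direction x)) ω‖ ≤ B k * (δ ^ k)⁻¹

/-- The convolution kernel `z ↦ e^{iλ|z|} / |z| * χ(z/|z|)`. -/
def coneKernel (lam : ℝ) (χ : E3 → ℝ) (z : E3) : ℂ :=
  Complex.exp (Complex.I * ((lam * ‖z‖ : ℝ) : ℂ)) / ((‖z‖ : ℝ) : ℂ) * ((χ (direction z) : ℝ) : ℂ)

/-- The gradient `(∂₁ g, ∂₂ g, ∂₃ g)` of a complex-valued function on three-space. -/
def cgrad (g : E3 → ℂ) (x : E3) : EuclideanSpace ℂ (Fin 3) :=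
  WithLp.toLp 2 fun j => fderiv ℝ g x (EuclideanSpace.single j 1)

/-- The weighted kernel `w(x) e^{iλ|x-y|}/|x-y| χ((x-y)/|x-y|) w(y)`. -/
def Qtilde (σ lam : ℝ) (χ : E3 → ℝ) (x y : E3) : ℂ :=
  ((weight σ x : ℝ) : ℂ) * coneKernel lam χ (x - y) * ((weight σ y : ℝ) : ℂ)

/-- The weighted kernel `w(x) ∇ₓ[e^{iλ|x-y|}/|x-y| χ((x-y)/|x-y|)] w(y)`. -/
def Qgrad (σ lam : ℝ) (χ : E3 → ℝ) (x y : E3) : EuclideanSpace ℂ (Fin 3) :=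
  ((weight σ x * weight σ y : ℝ) : ℂ) • cgrad (fun x' => coneKernel lam χ (x' - y)) x

/-- The integral operator `f ↦ ∫ k(·, y) f(y) dy` is well defined by absolutely convergent
integrals (for every `f ∈ L²` and almost every `x`), maps `L²(ℝ³; ℂ)` to `L²(ℝ³; F)`,
and has operator norm at most `C`. -/
def HasL2OpNormLE {F : Type} [NormedAddCommGroup F] [NormedSpace ℂ F]
    (k : E3 → E3 → F) (C : ℝ) : Prop :=
  ∃ T : Lp ℂ 2 (volume : Measure E3) →L[ℂ] Lp F 2 (volume : Measure E3),
    (∀ f : Lp ℂ 2 (volume : Measure E3), ∀ᵐ x ∂(volume : Measure E3),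
      Integrable (fun y => f y • k x y) (volume : Measure E3) ∧
        T f x = ∫ y, f y • k x y ∂(volume : Measure E3)) ∧
    ‖T‖ ≤ C

end

/-!
The proof cuts space by the planes orthogonal to the axis `ω₀` of the cone, with coordinates
`z = Φ (t, u)`, `t` along the axis and `u` in the plane. Since the weights are dominated by
integrable functions of the height alone, it suffices to bound, uniformly in `t`, the convolution
by each slice `u ↦ K (Φ (t, u))` on `L²` of the plane (`lintegral_weighted_conv_le`): slices at
different heights are only added up. No dyadic decomposition is needed, and absolute convergence comes from a
Schur test with non-quantitative constants.

A slice of the cone at height `t` is supported in `|u| ≤ 2 δ t`, where the distance to the origin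
`φ(u) = (t² + |u|²)^{1/2}` is at most `2 t`, and its amplitude has size `t⁻¹` and varies at the
scale `δ t`. By the `TT*` argument (`convBound_of_autocorrelation`) the square of the norm of the
slice `e^{iλφ} b` is at most the `L¹` norm of its autocorrelation
`h ↦ ∫ e^{iλ(φ(u + h) - φ(u))} b(u + h) b(u) du`. The derivative of the phase in the direction `h`
is at least `|h|² / (8 t)` there, by convexity of `φ`, so three integrations by parts in that
direction give the bound `C δ² (1 + λ δ |h|)⁻³` (`exists_norm_autocorrelation_le`). Its integral
over the plane is `C λ⁻²`, independently of `δ` and `t`: this is the first estimate.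

For the gradient, differentiating the exponential yields `iλ` times the same kernel with the cut-off
`χ(ω)` replaced by `χ(ω) ω_j`, which is adapted to the same cap
(`exists_isCapCutoff_coordCutoff`); the first estimate bounds it by a constant. The remaining terms
are at most `C δ⁻¹ |z|⁻²` on the cone, and since the slices have area at most `C δ² t²`, their
slices are bounded by `C δ` in `L¹` (`exists_convBound_gradRemainder`).
-/

open scoped ENNReal

/-! ### The Schur test and integral operators on `L²` -/

theorem sq_lintegral_mul_le {α : Type*} [MeasurableSpace α] {μ : Measure α} {f g : α → ℝ≥0∞}
    (hf : AEMeasurable f μ) (hg : AEMeasurable g μ) :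
    (∫⁻ a, f a * g a ∂μ) ^ 2 ≤ (∫⁻ a, f a ^ 2 ∂μ) * ∫⁻ a, g a ^ 2 ∂μ := by
  have h := ENNReal.lintegral_mul_le_Lp_mul_Lq μ Real.HolderConjugate.two_two hf hg
  simp only [Pi.mul_apply, ENNReal.rpow_two] at h
  have hsq : ∀ c : ℝ≥0∞, (c ^ (1 / 2 : ℝ)) ^ 2 = c := fun c => by
    rw [← ENNReal.rpow_natCast, ← ENNReal.rpow_mul]; norm_num
  calc (∫⁻ a, f a * g a ∂μ) ^ 2
      ≤ ((∫⁻ a, f a ^ 2 ∂μ) ^ (1 / 2 : ℝ) * (∫⁻ a, g a ^ 2 ∂μ) ^ (1 / 2 : ℝ)) ^ 2 := by gcongr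
    _ = _ := by rw [mul_pow, hsq, hsq]

/-- Cauchy–Schwarz with respect to the measure of density `k`. -/
theorem sq_lintegral_weighted_le {α : Type*} [MeasurableSpace α] {μ : Measure α}
    {k f : α → ℝ≥0∞} (hk : AEMeasurable k μ) (hf : AEMeasurable f μ) :
    (∫⁻ a, k a * f a ∂μ) ^ 2 ≤ (∫⁻ a, k a ∂μ) * ∫⁻ a, k a * f a ^ 2 ∂μ := by
  have hsq : ∀ c : ℝ≥0∞, (c ^ (1 / 2 : ℝ)) ^ 2 = c := fun c => by
    rw [← ENNReal.rpow_natCast, ← ENNReal.rpow_mul]; norm_num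
  have h := sq_lintegral_mul_le (hk.pow_const (1 / 2 : ℝ)) ((hk.pow_const (1 / 2 : ℝ)).mul hf)
  simpa only [Pi.mul_apply, mul_pow, hsq, ← mul_assoc, ← sq] using h

/-- **Schur test** for nonnegative kernels. -/
theorem lintegral_sq_lintegral_le {α β : Type*} [MeasurableSpace α] [MeasurableSpace β]
    {μ : Measure α} {ν : Measure β} [SFinite μ] [SFinite ν] {k : α → β → ℝ≥0∞}
    (hk : Measurable (Function.uncurry k)) {A A' : ℝ≥0∞} (hA : ∀ x, ∫⁻ y, k x y ∂ν ≤ A)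
    (hA' : ∀ y, ∫⁻ x, k x y ∂μ ≤ A') {f : β → ℝ≥0∞} (hf : Measurable f) :
    ∫⁻ x, (∫⁻ y, k x y * f y ∂ν) ^ 2 ∂μ ≤ A * A' * ∫⁻ y, f y ^ 2 ∂ν := by
  have hk1 : ∀ x, Measurable (k x) := fun x => hk.comp measurable_prodMk_left
  have hk2 : ∀ y, Measurable fun x => k x y := fun y => hk.comp measurable_prodMk_right
  have hm : Measurable (Function.uncurry fun x y => k x y * f y ^ 2) :=
    hk.mul ((hf.comp measurable_snd).pow_const 2)
  calc ∫⁻ x, (∫⁻ y, k x y * f y ∂ν) ^ 2 ∂μ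
      ≤ ∫⁻ x, A * ∫⁻ y, k x y * f y ^ 2 ∂ν ∂μ := by
        refine lintegral_mono fun x => ?_
        refine (sq_lintegral_weighted_le (hk1 x).aemeasurable hf.aemeasurable).trans ?_
        gcongr
        exact hA x
    _ = A * ∫⁻ y, (∫⁻ x, k x y ∂μ) * f y ^ 2 ∂ν := by
        rw [lintegral_const_mul _ hm.lintegral_prod_right, lintegral_lintegral_swap hm.aemeasurable]
        congr 1
        refine lintegral_congr fun y => ?_
        rw [lintegral_mul_const _ (hk2 y)]
    _ ≤ A * ∫⁻ y, A' * f y ^ 2 ∂ν := by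
        gcongr with y
        exact hA' y
    _ = _ := by rw [lintegral_const_mul _ (hf.pow_const 2), mul_assoc]

theorem ae_lt_top_of_sq_lintegral {α : Type*} [MeasurableSpace α] {μ : Measure α}
    {g : α → ℝ≥0∞} (hg : Measurable g) (h : ∫⁻ x, g x ^ 2 ∂μ ≠ ∞) : ∀ᵐ x ∂μ, g x < ∞ := by
  filter_upwards [ae_lt_top (hg.pow_const 2) h] with x hx
  by_contra hcon
  simp only [not_lt, top_le_iff] at hcon
  simp [hcon] at hx

theorem eLpNorm_two_sq {α F : Type*} [MeasurableSpace α] {μ : Measure α} [NormedAddCommGroup F]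
    (f : α → F) : eLpNorm f 2 μ ^ 2 = ∫⁻ x, ‖f x‖ₑ ^ 2 ∂μ := by
  rw [eLpNorm_eq_lintegral_rpow_enorm_toReal (by norm_num) (by norm_num)]
  rw [← ENNReal.rpow_natCast, ← ENNReal.rpow_mul]
  norm_num

theorem lintegral_sq_enorm_lp_ne_top (f : Lp ℂ 2 (volume : Measure E3)) :
    ∫⁻ x, ‖f x‖ₑ ^ 2 ≠ ∞ := by
  rw [← eLpNorm_two_sq]
  exact ENNReal.pow_ne_top (Lp.eLpNorm_ne_top f)

/-- A kernel satisfying the Schur test, whatever the bound, whose operator obeys an `L²` estimate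
with constant `C` on all measurable functions, defines an operator of norm at most `C`: the Schur
test is only used for the absolute convergence. -/
theorem hasL2OpNormLE_of_lintegral_le {k : E3 → E3 → ℂ} (hk : Measurable (Function.uncurry k))
    {A : ℝ≥0∞} (hAtop : A ≠ ∞) (hA : ∀ x, ∫⁻ y, ‖k x y‖ₑ ≤ A) (hA' : ∀ y, ∫⁻ x, ‖k x y‖ₑ ≤ A)
    {C : ℝ} (hC : 0 ≤ C)
    (hbound : ∀ f : E3 → ℂ, Measurable f →
      ∫⁻ x, ‖∫ y, f y • k x y‖ₑ ^ 2 ≤ ENNReal.ofReal C ^ 2 * ∫⁻ y, ‖f y‖ₑ ^ 2) :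
    HasL2OpNormLE k C := by
  have hfm : ∀ f : Lp ℂ 2 (volume : Measure E3), Measurable f := fun f =>
    (Lp.stronglyMeasurable f).measurable
  have hm : ∀ f : Lp ℂ 2 (volume : Measure E3),
      Measurable (Function.uncurry fun x y => f y • k x y) := fun f =>
    ((hfm f).comp measurable_snd).smul hk
  have hint : ∀ f : Lp ℂ 2 (volume : Measure E3), ∀ᵐ x ∂(volume : Measure E3),
      Integrable (fun y => f y • k x y) (volume : Measure E3) := by
    intro f
    have h1 := lintegral_sq_lintegral_le (μ := volume) (ν := volume)
      (k := fun x y => ‖k x y‖ₑ) hk.enorm hA hA' (hfm f).enorm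
    have h2 : ∫⁻ x, (∫⁻ y, ‖k x y‖ₑ * ‖f y‖ₑ) ^ 2 ≠ ∞ := by
      refine ne_top_of_le_ne_top ?_ h1
      exact ENNReal.mul_ne_top (ENNReal.mul_ne_top hAtop hAtop) (lintegral_sq_enorm_lp_ne_top f)
    have h3 : Measurable fun x => ∫⁻ y, ‖k x y‖ₑ * ‖f y‖ₑ := by
      refine Measurable.lintegral_prod_right (f := fun x y => ‖k x y‖ₑ * ‖f y‖ₑ) ?_
      exact hk.enorm.mul ((hfm f).comp measurable_snd).enorm
    filter_upwards [ae_lt_top_of_sq_lintegral h3 h2] with x hx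
    refine ⟨((hm f).comp measurable_prodMk_left).aestronglyMeasurable, ?_⟩
    rw [hasFiniteIntegral_iff_enorm]
    simpa only [enorm_smul, mul_comm] using hx
  have hsm : ∀ f : Lp ℂ 2 (volume : Measure E3),
      AEStronglyMeasurable (fun x => ∫ y, f y • k x y) (volume : Measure E3) := fun f =>
    ((hm f).stronglyMeasurable.integral_prod_right).aestronglyMeasurable
  have hnorm : ∀ f : Lp ℂ 2 (volume : Measure E3),
      eLpNorm (fun x => ∫ y, f y • k x y) 2 volume ≤ ENNReal.ofReal C * eLpNorm f 2 volume := by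
    intro f
    have := hbound f (hfm f)
    rw [← eLpNorm_two_sq, ← eLpNorm_two_sq, ← mul_pow] at this
    exact (ENNReal.pow_le_pow_left_iff two_ne_zero).1 this
  have hmem : ∀ f : Lp ℂ 2 (volume : Measure E3),
      MemLp (fun x => ∫ y, f y • k x y) 2 (volume : Measure E3) := fun f =>
    ⟨hsm f, (hnorm f).trans_lt (ENNReal.mul_lt_top ENNReal.ofReal_lt_top
      (Lp.eLpNorm_lt_top f))⟩
  let T₀ : Lp ℂ 2 (volume : Measure E3) →ₗ[ℂ] Lp ℂ 2 (volume : Measure E3) :=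
    { toFun := fun f => (hmem f).toLp _
      map_add' := by
        intro f g
        rw [← MemLp.toLp_add]
        refine MemLp.toLp_congr _ _ ?_
        filter_upwards [hint f, hint g] with x hf hg
        rw [Pi.add_apply, ← integral_add hf hg]
        refine integral_congr_ae ?_
        filter_upwards [Lp.coeFn_add f g] with y hy
        rw [hy, Pi.add_apply, add_smul]
      map_smul' := by
        intro c f
        rw [RingHom.id_apply, ← MemLp.toLp_const_smul]
        refine MemLp.toLp_congr _ _ ?_
        filter_upwards with x
        rw [Pi.smul_apply, ← integral_smul]
        refine integral_congr_ae ?_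
        filter_upwards [Lp.coeFn_smul c f] with y hy
        rw [hy, Pi.smul_apply, smul_assoc] }
  have hT₀ : ∀ f, ‖T₀ f‖ ≤ C * ‖f‖ := by
    intro f
    change ‖(hmem f).toLp _‖ ≤ _
    rw [Lp.norm_toLp, Lp.norm_def, ← ENNReal.toReal_ofReal hC, ← ENNReal.toReal_mul]
    exact ENNReal.toReal_mono (ENNReal.mul_ne_top ENNReal.ofReal_ne_top (Lp.eLpNorm_ne_top f))
      (by simpa only [ENNReal.toReal_ofReal hC] using hnorm f)
  refine ⟨T₀.mkContinuous C hT₀, fun f => ?_, LinearMap.mkContinuous_norm_le _ hC _⟩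
  filter_upwards [hint f, (hmem f).coeFn_toLp] with x h1 h2
  exact ⟨h1, h2⟩

theorem HasL2OpNormLE.mono {F : Type} [NormedAddCommGroup F] [NormedSpace ℂ F]
    {k : E3 → E3 → F} {C C' : ℝ} (h : HasL2OpNormLE k C) (hC : C ≤ C') : HasL2OpNormLE k C' := by
  obtain ⟨T, hT, hn⟩ := h
  exact ⟨T, hT, hn.trans hC⟩

theorem HasL2OpNormLE.congr {F : Type} [NormedAddCommGroup F] [NormedSpace ℂ F]
    {k k' : E3 → E3 → F} {C : ℝ} (h : HasL2OpNormLE k C)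
    (hkk' : ∀ x, ∀ᵐ y ∂(volume : Measure E3), k x y = k' x y) : HasL2OpNormLE k' C := by
  obtain ⟨T, hT, hn⟩ := h
  refine ⟨T, fun f => ?_, hn⟩
  filter_upwards [hT f] with x hx
  have he : (fun y => f y • k x y) =ᵐ[volume] fun y => f y • k' x y := by
    filter_upwards [hkk' x] with y hy
    rw [hy]
  exact ⟨hx.1.congr he, hx.2.trans (integral_congr_ae he)⟩

theorem HasL2OpNormLE.add {F : Type} [NormedAddCommGroup F] [NormedSpace ℂ F]
    {k k' : E3 → E3 → F} {C C' : ℝ} (h : HasL2OpNormLE k C) (h' : HasL2OpNormLE k' C') :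
    HasL2OpNormLE (fun x y => k x y + k' x y) (C + C') := by
  obtain ⟨T, hT, hn⟩ := h
  obtain ⟨T', hT', hn'⟩ := h'
  refine ⟨T + T', fun f => ?_, (norm_add_le _ _).trans (add_le_add hn hn')⟩
  filter_upwards [hT f, hT' f, Lp.coeFn_add (T f) (T' f)] with x h1 h2 h3
  simp only [smul_add]
  refine ⟨h1.1.add h2.1, ?_⟩
  rw [integral_add h1.1 h2.1, ← h1.2, ← h2.2]
  exact h3

theorem HasL2OpNormLE.clm_apply {F G : Type} [NormedAddCommGroup F] [NormedSpace ℂ F]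
    [CompleteSpace F] [NormedAddCommGroup G] [NormedSpace ℂ G] [CompleteSpace G]
    {k : E3 → E3 → F} {C : ℝ} (h : HasL2OpNormLE k C)
    (L : F →L[ℂ] G) : HasL2OpNormLE (fun x y => L (k x y)) (‖L‖ * C) := by
  obtain ⟨T, hT, hn⟩ := h
  refine ⟨(L.compLpL 2 volume).comp T, fun f => ?_, ?_⟩
  · filter_upwards [hT f, L.coeFn_compLp (T f)] with x h1 h2
    refine ⟨by simpa only [map_smul] using L.integrable_comp h1.1, ?_⟩
    simp only [← map_smul]
    rw [L.integral_comp_comm h1.1, ← h1.2]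
    exact h2
  · refine (ContinuousLinearMap.opNorm_comp_le _ _).trans ?_
    gcongr
    exact ContinuousLinearMap.norm_compLpL_le L

theorem HasL2OpNormLE.const_mul {k : E3 → E3 → ℂ} {C : ℝ} (h : HasL2OpNormLE k C) (c : ℂ) :
    HasL2OpNormLE (fun x y => c * k x y) (‖c‖ * C) := by
  have := h.clm_apply (c • ContinuousLinearMap.id ℂ ℂ)
  simp only [smul_apply, ContinuousLinearMap.id_apply, smul_eq_mul] at this
  refine this.mono (le_of_eq ?_)
  rw [norm_smul, ContinuousLinearMap.norm_id, mul_one]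

theorem hasL2OpNormLE_zero {F : Type} [NormedAddCommGroup F] [NormedSpace ℂ F] :
    HasL2OpNormLE (fun _ _ => (0 : F)) 0 := by
  refine ⟨0, fun f => ?_, by simp⟩
  filter_upwards [Lp.coeFn_zero F 2 (volume : Measure E3)] with x _
  simp

theorem HasL2OpNormLE.finset_sum {ι : Type*} (s : Finset ι) {F : Type} [NormedAddCommGroup F]
    [NormedSpace ℂ F] {k : ι → E3 → E3 → F} {C : ι → ℝ} (h : ∀ i, HasL2OpNormLE (k i) (C i)) :
    HasL2OpNormLE (fun x y => ∑ i ∈ s, k i x y) (∑ i ∈ s, C i) := by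
  classical
  induction s using Finset.induction_on with
  | empty => simpa using hasL2OpNormLE_zero
  | insert i s hi ih => simpa only [Finset.sum_insert hi] using (h i).add ih

/-- An operator into `L²(ℝ³; ℂ³)` is controlled by its three components. -/
theorem hasL2OpNormLE_of_components {k : E3 → E3 → EuclideanSpace ℂ (Fin 3)} {C : ℝ}
    (h : ∀ j, HasL2OpNormLE (fun x y => k x y j) C) : HasL2OpNormLE k (3 * C) := by
  have h1 : ∀ j, HasL2OpNormLE
      (fun x y => (k x y j) • EuclideanSpace.single j (1 : ℂ)) C := fun j => by
    have := (h j).clm_apply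
      (ContinuousLinearMap.toSpanSingleton ℂ (EuclideanSpace.single j (1 : ℂ)))
    simpa [ContinuousLinearMap.norm_toSpanSingleton] using this
  have h2 := HasL2OpNormLE.finset_sum Finset.univ h1
  simp only [Finset.sum_const, Finset.card_univ, Fintype.card_fin, nsmul_eq_mul] at h2
  refine HasL2OpNormLE.congr (by simpa using h2) fun x => Filter.Eventually.of_forall fun y => ?_
  ext i
  simp [Pi.single_apply]

/-! ### Slicing by planes orthogonal to the axis of the cone -/

/-- The Euclidean plane, model for the planes orthogonal to the axis of the cone. -/
abbrev E2 : Type := EuclideanSpace ℝ (Fin 2)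

/-- Coordinates on three-space: the component along a unit vector `ω₀` and the transverse part. -/
theorem exists_axial_coordinates {ω₀ : E3} (hω₀ : ‖ω₀‖ = 1) :
    ∃ Φ : (ℝ × E2) ≃L[ℝ] E3, MeasurePreserving Φ volume volume ∧
      (∀ p, ‖Φ p‖ ^ 2 = p.1 ^ 2 + ‖p.2‖ ^ 2) ∧ Φ (1, 0) = ω₀ := by
  have hfr : Module.finrank ℝ (WithLp 2 (ℝ × E2)) = Module.finrank ℝ E3 := by
    rw [(WithLp.linearEquiv 2 ℝ (ℝ × E2)).finrank_eq]
    simp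
  let L₀ : WithLp 2 (ℝ × E2) ≃ₗᵢ[ℝ] E3 :=
    (stdOrthonormalBasis ℝ (WithLp 2 (ℝ × E2))).equiv (stdOrthonormalBasis ℝ E3) (finCongr hfr)
  set e : WithLp 2 (ℝ × E2) := WithLp.toLp 2 (1, 0) with he
  have hnorm : ∀ p : ℝ × E2, ‖(WithLp.toLp 2 p : WithLp 2 (ℝ × E2))‖ ^ 2
      = p.1 ^ 2 + ‖p.2‖ ^ 2 := fun p => by
    rw [WithLp.prod_norm_sq_eq_of_L2]
    simp
  have hv : ‖L₀ e‖ = ‖ω₀‖ := by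
    have : ‖e‖ ^ 2 = 1 := by rw [he, hnorm]; simp
    rw [L₀.norm_map, hω₀]
    nlinarith [norm_nonneg e]
  -- correct the image of the first axis by a reflection exchanging it with `ω₀`
  let R : E3 ≃ₗᵢ[ℝ] E3 := (Submodule.span ℝ {L₀ e - ω₀})ᗮ.reflection
  have hR : R (L₀ e) = ω₀ := Submodule.reflection_sub hv
  let L : WithLp 2 (ℝ × E2) ≃ₗᵢ[ℝ] E3 := L₀.trans R
  refine ⟨(WithLp.prodContinuousLinearEquiv 2 ℝ ℝ E2).symm.trans L.toContinuousLinearEquiv,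
    ?_, fun p => ?_, hR⟩
  · exact L.measurePreserving.comp (WithLp.volume_preserving_toLp ℝ E2)
  · change ‖L (WithLp.toLp 2 p)‖ ^ 2 = _
    rw [L.norm_map, hnorm]

/-- Convolution with `k` on the plane is bounded on `L²` with norm at most `N`. -/
def ConvBound (k : E2 → ℂ) (N : ℝ) : Prop :=
  ∀ f : E2 → ℂ, Measurable f →
    ∫⁻ u, ‖∫ v, f v * k (u - v)‖ₑ ^ 2 ≤ ENNReal.ofReal N ^ 2 * ∫⁻ v, ‖f v‖ₑ ^ 2

/-- The weight restricted to the axis of the cone. -/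
noncomputable def axialWeight (σ s : ℝ) : ℝ := Real.sqrt (1 + s ^ 2) ^ (-σ)

theorem axialWeight_pos (σ s : ℝ) : 0 < axialWeight σ s := by
  unfold axialWeight; positivity

theorem weight_pos (σ : ℝ) (x : E3) : 0 < weight σ x := by
  unfold weight; positivity

theorem one_le_sqrt_one_add_sq (s : ℝ) : 1 ≤ Real.sqrt (1 + s ^ 2) := by
  rw [Real.one_le_sqrt]; nlinarith [sq_nonneg s]

theorem axialWeight_le_one {σ : ℝ} (hσ : 0 ≤ σ) (s : ℝ) : axialWeight σ s ≤ 1 :=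
  Real.rpow_le_one_of_one_le_of_nonpos (one_le_sqrt_one_add_sq s) (by linarith)

theorem weight_le_one {σ : ℝ} (hσ : 0 ≤ σ) (x : E3) : weight σ x ≤ 1 :=
  axialWeight_le_one hσ ‖x‖

theorem measurable_axialWeight (σ : ℝ) : Measurable (axialWeight σ) := by
  unfold axialWeight; fun_prop

theorem measurable_weight (σ : ℝ) : Measurable (weight σ) := by
  unfold weight; fun_prop

theorem sqrt_rpow_neg_eq (σ a : ℝ) (ha : 0 ≤ a) : Real.sqrt a ^ (-σ) = a ^ (-σ / 2) := by
  rw [Real.sqrt_eq_rpow, ← Real.rpow_mul ha]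
  congr 1
  ring

theorem integrable_axialWeight {σ : ℝ} (hσ : 1 < σ) : Integrable (axialWeight σ) := by
  have := integrable_rpow_neg_one_add_norm_sq (E := ℝ) (μ := volume) (r := σ) (by simpa using hσ)
  refine this.congr (Filter.Eventually.of_forall fun s => ?_)
  simp only [axialWeight]
  rw [sqrt_rpow_neg_eq _ _ (by positivity), Real.norm_eq_abs, sq_abs]

theorem integrable_weight {σ : ℝ} (hσ : 3 < σ) : Integrable (weight σ) := by
  have := integrable_rpow_neg_one_add_norm_sq (E := E3) (μ := volume) (r := σ) (by simpa using hσ)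
  refine this.congr (Filter.Eventually.of_forall fun s => ?_)
  simp only [weight]
  rw [sqrt_rpow_neg_eq _ _ (by positivity)]

theorem weight_le_axialWeight {σ : ℝ} (hσ : 0 ≤ σ) {Φ : (ℝ × E2) ≃L[ℝ] E3}
    (hΦ : ∀ p, ‖Φ p‖ ^ 2 = p.1 ^ 2 + ‖p.2‖ ^ 2) (p : ℝ × E2) :
    weight σ (Φ p) ≤ axialWeight σ p.1 := by
  unfold weight axialWeight
  refine Real.rpow_le_rpow_of_nonpos (by positivity) (Real.sqrt_le_sqrt ?_) (by linarith)
  rw [hΦ]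
  nlinarith [sq_nonneg ‖p.2‖]

/-- Fubini as an inequality valid for every `g`: the left side is zero when `g` is not
integrable. -/
theorem enorm_integral_prod_le {α β : Type*} [MeasurableSpace α] [MeasurableSpace β]
    {μ : Measure α} {ν : Measure β} [SFinite μ] [SFinite ν] (g : α × β → ℂ) :
    ‖∫ q, g q ∂(μ.prod ν)‖ₑ ≤ ∫⁻ r, ‖∫ v, g (r, v) ∂ν‖ₑ ∂μ := by
  by_cases hg : Integrable g (μ.prod ν)
  · rw [integral_prod _ hg]
    exact enorm_integral_le_lintegral_enorm _
  · rw [integral_undef hg]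
    simp

/-- Uniform `L²` bounds for the convolutions by the slices of `K` give an `L²` bound for the
weighted convolution by `K`: slices at different heights do not interact, and the weights make the
sum over heights converge. -/
theorem lintegral_weighted_conv_le {σ : ℝ} (hσ : 0 ≤ σ) {Φ : (ℝ × E2) ≃L[ℝ] E3}
    (hmp : MeasurePreserving Φ volume volume)
    (hΦ : ∀ p, ‖Φ p‖ ^ 2 = p.1 ^ 2 + ‖p.2‖ ^ 2) {K : E3 → ℂ} (hK : Measurable K) {N : ℝ}
    (hN : ∀ t : ℝ, t ≠ 0 → ConvBound (fun u => K (Φ (t, u))) N)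
    {f : E3 → ℂ} (hf : Measurable f) :
    ∫⁻ x, ‖∫ y, f y • ((weight σ x : ℂ) * K (x - y) * (weight σ y : ℂ))‖ₑ ^ 2 ≤
      ((∫⁻ s, ENNReal.ofReal (axialWeight σ s)) * ENNReal.ofReal N) ^ 2 * ∫⁻ y, ‖f y‖ₑ ^ 2 := by
  have hwm : Measurable fun x : E3 => (weight σ x : ℂ) :=
    Complex.measurable_ofReal.comp (measurable_weight σ)
  have hΦm : Measurable Φ := Φ.continuous.measurable
  have hkm : Measurable (Function.uncurry fun x y : E3 =>
      f y • ((weight σ x : ℂ) * K (x - y) * (weight σ y : ℂ))) := by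
    refine (hf.comp measurable_snd).smul (((hwm.comp measurable_fst).mul
      (hK.comp (measurable_fst.sub measurable_snd))).mul (hwm.comp measurable_snd))
  set F : E3 → ℂ := fun x => ∫ y, f y • ((weight σ x : ℂ) * K (x - y) * (weight σ y : ℂ)) with hF
  have hFm : Measurable F := (hkm.stronglyMeasurable.integral_prod_right).measurable
  set m : ℝ → ℝ≥0∞ := fun s => ENNReal.ofReal (axialWeight σ s) with hm
  have hmm : Measurable m := (measurable_axialWeight σ).ennreal_ofReal
  have hm1 : ∀ s, m s ≤ 1 := fun s =>
    ENNReal.ofReal_le_one.2 (axialWeight_le_one hσ s)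
  -- the function with part of its weight removed
  set f' : ℝ × E2 → ℂ := fun q =>
    ((weight σ (Φ q) / axialWeight σ q.1 : ℝ) : ℂ) * f (Φ q) with hf'
  have hf'm : Measurable f' := by
    refine Measurable.mul (Complex.measurable_ofReal.comp ?_) (hf.comp hΦm)
    exact ((measurable_weight σ).comp hΦm).div ((measurable_axialWeight σ).comp measurable_fst)
  have hf'le : ∀ q, ‖f' q‖ₑ ≤ ‖f (Φ q)‖ₑ := by
    intro q
    rw [hf', enorm_mul]
    refine mul_le_of_le_one_left (by simp) ?_
    rw [← ofReal_norm, Complex.norm_real, Real.norm_of_nonneg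
      (div_pos (weight_pos _ _) (axialWeight_pos _ _)).le, ENNReal.ofReal_le_one]
    exact div_le_one_of_le₀ (weight_le_axialWeight hσ hΦ q) (axialWeight_pos _ _).le
  set J : ℝ → E2 → ℝ → ℝ≥0∞ := fun s u r =>
    ‖∫ v, f' (r, v) * K (Φ (s - r, u - v))‖ₑ with hJ
  have hJm : Measurable fun p : (ℝ × E2) × ℝ => J p.1.1 p.1.2 p.2 := by
    have h0 : Measurable fun p : ((ℝ × E2) × ℝ) × E2 =>
        f' (p.1.2, p.2) * K (Φ (p.1.1.1 - p.1.2, p.1.1.2 - p.2)) := by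
      refine Measurable.mul (hf'm.comp (by fun_prop)) (hK.comp (hΦm.comp (by fun_prop)))
    exact (h0.stronglyMeasurable.integral_prod_right').measurable.enorm
  have hFle : ∀ s u, ‖F (Φ (s, u))‖ₑ ≤ m s * ∫⁻ r, m r * J s u r := by
    intro s u
    have h1 : F (Φ (s, u)) = (weight σ (Φ (s, u)) : ℂ) *
        ∫ q : ℝ × E2, (axialWeight σ q.1 : ℂ) * (f' q * K (Φ (s - q.1, u - q.2))) := by
      rw [hF, ← integral_const_mul]
      simp only
      rw [← hmp.integral_comp Φ.toHomeomorph.measurableEmbedding]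
      refine integral_congr_ae (Filter.Eventually.of_forall fun q => ?_)
      have hne : (axialWeight σ q.1 : ℂ) ≠ 0 := by
        exact_mod_cast (axialWeight_pos σ q.1).ne'
      have hsub : Φ (s - q.1, u - q.2) = Φ (s, u) - Φ q := by
        rw [← map_sub]; rfl
      simp only [hf', hsub, smul_eq_mul, Complex.ofReal_div]
      field_simp
    rw [h1, enorm_mul]
    refine mul_le_mul' ?_ ?_
    · rw [← ofReal_norm, Complex.norm_real, Real.norm_of_nonneg (weight_pos _ _).le]
      exact ENNReal.ofReal_le_ofReal (weight_le_axialWeight hσ hΦ (s, u))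
    · rw [Measure.volume_eq_prod]
      refine (enorm_integral_prod_le _).trans (lintegral_mono fun r => ?_)
      simp only
      rw [integral_const_mul, enorm_mul, ← ofReal_norm, Complex.norm_real,
        Real.norm_of_nonneg (axialWeight_pos _ _).le]
  have hJ2 : ∀ s r, s ≠ r → ∫⁻ u, J s u r ^ 2 ≤ ENNReal.ofReal N ^ 2 * ∫⁻ v, ‖f' (r, v)‖ₑ ^ 2 :=
    fun s r hsr => hN (s - r) (sub_ne_zero.2 hsr) (fun v => f' (r, v))
      (hf'm.comp measurable_prodMk_left)
  set I : ℝ≥0∞ := ∫⁻ s, m s with hI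
  have hfr : Measurable fun r => ∫⁻ v, ‖f' (r, v)‖ₑ ^ 2 :=
    Measurable.lintegral_prod_right' (f := fun q => ‖f' q‖ₑ ^ 2) (hf'm.enorm.pow_const 2)
  -- Cauchy–Schwarz in `r` against the weight `m`, then the bound of each slice
  have hslice : ∀ s, ∫⁻ u, ‖F (Φ (s, u))‖ₑ ^ 2 ≤
      m s * (I * (ENNReal.ofReal N ^ 2 * ∫⁻ y, ‖f y‖ₑ ^ 2)) := by
    intro s
    have hJs : Measurable fun p : E2 × ℝ => J s p.1 p.2 :=
      hJm.comp (f := fun p : E2 × ℝ => ((s, p.1), p.2)) (by fun_prop)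
    have hJm2 : Measurable (Function.uncurry fun (u : E2) (r : ℝ) => m r * J s u r ^ 2) :=
      (hmm.comp measurable_snd).mul (hJs.pow_const 2)
    calc ∫⁻ u, ‖F (Φ (s, u))‖ₑ ^ 2
        ≤ ∫⁻ u, m s * (I * ∫⁻ r, m r * J s u r ^ 2) := by
          refine lintegral_mono fun u => ?_
          calc ‖F (Φ (s, u))‖ₑ ^ 2 ≤ (m s * ∫⁻ r, m r * J s u r) ^ 2 := by
                gcongr
                exact hFle s u
            _ = m s * (m s * (∫⁻ r, m r * J s u r) ^ 2) := by ring
            _ ≤ m s * (1 * (I * ∫⁻ r, m r * J s u r ^ 2)) := by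
                gcongr
                · exact hm1 s
                · exact sq_lintegral_weighted_le hmm.aemeasurable
                    (hJs.comp (f := fun r : ℝ => (u, r)) (by fun_prop)).aemeasurable
            _ = _ := by rw [one_mul]
      _ = m s * (I * ∫⁻ r, m r * ∫⁻ u, J s u r ^ 2) := by
          rw [lintegral_const_mul _ (hJm2.lintegral_prod_right.const_mul _),
            lintegral_const_mul _ hJm2.lintegral_prod_right,
            lintegral_lintegral_swap hJm2.aemeasurable]
          congr 2
          refine lintegral_congr fun r => ?_
          rw [lintegral_const_mul]
          exact (hJs.comp (f := fun u : E2 => (u, r)) (by fun_prop)).pow_const 2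
      _ ≤ m s * (I * ∫⁻ r, ENNReal.ofReal N ^ 2 * ∫⁻ v, ‖f' (r, v)‖ₑ ^ 2) := by
          gcongr 2
          refine lintegral_mono_ae ?_
          have : ∀ᵐ r : ℝ, r ≠ s := by
            simp [ae_iff]
          filter_upwards [this] with r hr
          exact (mul_le_of_le_one_left (by simp) (hm1 r)).trans (hJ2 s r hr.symm)
      _ ≤ _ := by
          rw [lintegral_const_mul _ hfr]
          gcongr
          rw [← lintegral_prod (fun q : ℝ × E2 => ‖f' q‖ₑ ^ 2)
            (hf'm.enorm.pow_const 2).aemeasurable, ← Measure.volume_eq_prod,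
            ← hmp.lintegral_comp (hf.enorm.pow_const 2)]
          gcongr with q
          exact hf'le q
  calc ∫⁻ x, ‖F x‖ₑ ^ 2 = ∫⁻ s, ∫⁻ u, ‖F (Φ (s, u))‖ₑ ^ 2 := by
        rw [← hmp.lintegral_comp (hFm.enorm.pow_const 2), Measure.volume_eq_prod]
        exact lintegral_prod (fun q : ℝ × E2 => ‖F (Φ q)‖ₑ ^ 2)
          ((hFm.comp hΦm).enorm.pow_const 2).aemeasurable
    _ ≤ ∫⁻ s, m s * (I * (ENNReal.ofReal N ^ 2 * ∫⁻ y, ‖f y‖ₑ ^ 2)) := lintegral_mono hslice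
    _ = _ := by
        rw [lintegral_mul_const _ hmm]
        ring

theorem lintegral_inv_norm_sq_ball_lt_top :
    ∫⁻ z in Metric.ball (0 : E3) 1, ENNReal.ofReal ((‖z‖ ^ 2)⁻¹) < ∞ := by
  have h : IntegrableOn (fun z : E3 => (‖z‖ ^ 2)⁻¹) (Metric.ball 0 1) := by
    rw [← integrable_indicator_iff measurableSet_ball]
    have h1 : Integrable (fun z : E3 => (Set.Iio (1 : ℝ)).indicator (fun r => (r ^ 2)⁻¹) ‖z‖) := by
      rw [integrable_fun_norm_addHaar (volume : Measure E3)
        (f := (Set.Iio (1 : ℝ)).indicator (fun r => (r ^ 2)⁻¹))]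
      have h2 : IntegrableOn (fun _ : ℝ => (1 : ℝ)) (Set.Ioo 0 1) := by simp
      rw [← integrable_indicator_iff measurableSet_Ioo] at h2
      refine (h2.integrableOn (s := Set.Ioi 0)).congr_fun (fun r (hr : 0 < r) => ?_)
        measurableSet_Ioi
      by_cases hr1 : r < 1
      · simp [Set.indicator, hr, hr1, hr.ne']
      · simp [Set.indicator, hr, hr1]
    refine h1.congr (Filter.Eventually.of_forall fun z => ?_)
    simp [Set.indicator]
  have := h.lintegral_lt_top
  exact this

/-- The Schur test for weighted convolution kernels with an inverse square singularity. -/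
theorem exists_lintegral_weighted_le {σ : ℝ} (hσ : 3 < σ) {K : E3 → ℂ}
    {C : ℝ} (hKC : ∀ z, ‖K z‖ ≤ C * (1 + (‖z‖ ^ 2)⁻¹)) :
    ∃ A : ℝ≥0∞, A ≠ ∞ ∧
      (∀ x, ∫⁻ y, ‖(weight σ x : ℂ) * K (x - y) * (weight σ y : ℂ)‖ₑ ≤ A) ∧
      ∀ y, ∫⁻ x, ‖(weight σ x : ℂ) * K (x - y) * (weight σ y : ℂ)‖ₑ ≤ A := by
  have hC : 0 ≤ C := by
    have := (norm_nonneg _).trans (hKC 0)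
    simpa using this
  set S : E3 → ℝ≥0∞ := (Metric.ball (0 : E3) 1).indicator fun z => ENNReal.ofReal ((‖z‖ ^ 2)⁻¹)
    with hS
  have hSm : Measurable S := Measurable.indicator (by fun_prop) measurableSet_ball
  have hSi : ∫⁻ z, S z < ∞ := by
    rw [hS, lintegral_indicator measurableSet_ball]
    exact lintegral_inv_norm_sq_ball_lt_top
  set W : E3 → ℝ≥0∞ := fun x => ENNReal.ofReal (weight σ x) with hW
  have hWm : Measurable W := (measurable_weight σ).ennreal_ofReal
  have hWi : ∫⁻ x, W x < ∞ := (integrable_weight hσ).lintegral_lt_top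
  have hW1 : ∀ x, W x ≤ 1 := fun x =>
    ENNReal.ofReal_le_one.2 (weight_le_one (by linarith) x)
  have hKe : ∀ z, ‖K z‖ₑ ≤ ENNReal.ofReal C * (2 + S z) := by
    intro z
    rw [← ofReal_norm]
    refine (ENNReal.ofReal_le_ofReal (hKC z)).trans ?_
    rw [ENNReal.ofReal_mul hC, ENNReal.ofReal_add (by norm_num) (by positivity)]
    refine mul_le_mul_right ?_ _
    by_cases hz : ‖z‖ < 1
    · have hSz : S z = ENNReal.ofReal ((‖z‖ ^ 2)⁻¹) :=
        Set.indicator_of_mem (by simpa using hz) _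
      rw [hSz]
      gcongr
      norm_num
    · have : ENNReal.ofReal ((‖z‖ ^ 2)⁻¹) ≤ 1 := by
        rw [ENNReal.ofReal_le_one]
        exact inv_le_one_of_one_le₀ (one_le_pow₀ (not_lt.1 hz))
      calc _ ≤ (1 : ℝ≥0∞) + 1 := add_le_add (by simp) this
        _ = 2 := by norm_num
        _ ≤ _ := le_self_add
  have hwe : ∀ x, ‖(weight σ x : ℂ)‖ₑ = W x := fun x => by
    rw [← ofReal_norm, Complex.norm_real, Real.norm_of_nonneg (weight_pos _ _).le]
  refine ⟨ENNReal.ofReal C * (2 * (∫⁻ x, W x) + ∫⁻ z, S z), ?_, fun x => ?_, fun y => ?_⟩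
  · exact ENNReal.mul_ne_top ENNReal.ofReal_ne_top (ENNReal.add_ne_top.2
      ⟨ENNReal.mul_ne_top (by norm_num) hWi.ne, hSi.ne⟩)
  · calc ∫⁻ y, ‖(weight σ x : ℂ) * K (x - y) * (weight σ y : ℂ)‖ₑ
        ≤ ∫⁻ y, ENNReal.ofReal C * (2 * W y + S (x - y)) := by
          refine lintegral_mono fun y => ?_
          rw [enorm_mul, enorm_mul, hwe, hwe]
          calc W x * ‖K (x - y)‖ₑ * W y
              ≤ 1 * (ENNReal.ofReal C * (2 + S (x - y))) * W y := by
                gcongr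
                exacts [hW1 x, hKe _]
            _ = ENNReal.ofReal C * (2 * W y + S (x - y) * W y) := by ring
            _ ≤ _ := by
                gcongr
                exact mul_le_of_le_one_right (by simp) (hW1 y)
      _ = _ := by
          rw [lintegral_const_mul _ (by fun_prop), lintegral_add_left (by fun_prop),
            lintegral_const_mul _ hWm, lintegral_sub_left_eq_self S x]
  · calc ∫⁻ x, ‖(weight σ x : ℂ) * K (x - y) * (weight σ y : ℂ)‖ₑ
        ≤ ∫⁻ x, ENNReal.ofReal C * (2 * W x + S (x - y)) := by
          refine lintegral_mono fun x => ?_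
          rw [enorm_mul, enorm_mul, hwe, hwe]
          calc W x * ‖K (x - y)‖ₑ * W y
              ≤ W x * (ENNReal.ofReal C * (2 + S (x - y))) * 1 := by
                gcongr
                exacts [hKe _, hW1 y]
            _ = ENNReal.ofReal C * (2 * W x + W x * S (x - y)) := by ring
            _ ≤ _ := by
                gcongr
                exact mul_le_of_le_one_left (by simp) (hW1 x)
      _ = _ := by
          rw [lintegral_const_mul _ (by fun_prop), lintegral_add_left (by fun_prop),
            lintegral_const_mul _ hWm, lintegral_sub_right_eq_self S y]

/-- Weighted convolution operators are bounded by their slices; the pointwise bound on `K` enters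
the absolute convergence only, not the norm. -/
theorem hasL2OpNormLE_of_slices {σ : ℝ} (hσ : 3 < σ) {Φ : (ℝ × E2) ≃L[ℝ] E3}
    (hmp : MeasurePreserving Φ volume volume)
    (hΦ : ∀ p, ‖Φ p‖ ^ 2 = p.1 ^ 2 + ‖p.2‖ ^ 2) {K : E3 → ℂ} (hK : Measurable K)
    {C : ℝ} (hKC : ∀ z, ‖K z‖ ≤ C * (1 + (‖z‖ ^ 2)⁻¹)) {N : ℝ} (hN0 : 0 ≤ N)
    (hN : ∀ t : ℝ, t ≠ 0 → ConvBound (fun u => K (Φ (t, u))) N) :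
    HasL2OpNormLE (fun x y => (weight σ x : ℂ) * K (x - y) * (weight σ y : ℂ))
      ((∫ s, axialWeight σ s) * N) := by
  obtain ⟨A, hAtop, hA, hA'⟩ := exists_lintegral_weighted_le hσ hKC
  have hI : 0 ≤ ∫ s, axialWeight σ s := integral_nonneg fun s => (axialWeight_pos σ s).le
  have hwm : Measurable fun x : E3 => (weight σ x : ℂ) :=
    Complex.measurable_ofReal.comp (measurable_weight σ)
  refine hasL2OpNormLE_of_lintegral_le ?_ hAtop hA hA' (mul_nonneg hI hN0) fun f hf => ?_
  · exact ((hwm.comp measurable_fst).mul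
      (hK.comp (measurable_fst.sub measurable_snd))).mul (hwm.comp measurable_snd)
  · rw [ENNReal.ofReal_mul hI, ofReal_integral_eq_lintegral_ofReal
      (integrable_axialWeight (by linarith))
      (Filter.Eventually.of_forall fun s => (axialWeight_pos σ s).le)]
    exact lintegral_weighted_conv_le (by linarith) hmp hΦ hK hN hf

/-! ### Convolution bounds on the plane -/

open ComplexConjugate in
/-- The `TT*` argument: the `L²` norm of a convolution is controlled by the `L¹` norm of the
autocorrelation of its kernel. -/
theorem convBound_of_autocorrelation {k : E2 → ℂ} (hk : Measurable k) (hki : Integrable k)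
    {N : ℝ} (hN : 0 < N)
    (hA : ∫⁻ h, ‖∫ u, k (u + h) * conj (k u)‖ₑ ≤ ENNReal.ofReal N ^ 2) : ConvBound k N := by
  intro f hf
  by_cases hfin : ∫⁻ v, ‖f v‖ₑ ^ 2 = ∞
  · rw [hfin, ENNReal.mul_top]
    · exact le_top
    · simpa using hN
  have hcm : Measurable (conj : ℂ → ℂ) := Complex.continuous_conj.measurable
  have hsm : Measurable fun p : E2 × E2 => k (p.1 - p.2) := hk.comp (by fun_prop)
  have ham : Measurable fun p : E2 × E2 => f p.2 * k (p.1 - p.2) :=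
    (hf.comp measurable_snd).mul hsm
  set T : E2 → ℂ := fun u => ∫ v, f v * k (u - v) with hT
  have hTm : Measurable T := ham.stronglyMeasurable.integral_prod_right'.measurable
  set P : E2 → ℝ≥0∞ := fun u => ∫⁻ v, ‖k (u - v)‖ₑ * ‖f v‖ₑ with hP
  have hki' : ∫⁻ v, ‖k v‖ₑ < ∞ := hki.2
  have hPfin : ∫⁻ u, P u ^ 2 < ∞ := by
    refine (lintegral_sq_lintegral_le (μ := volume) (ν := volume)
      (k := fun u v : E2 => ‖k (u - v)‖ₑ) hsm.enorm (A := ∫⁻ v, ‖k v‖ₑ) (A' := ∫⁻ v, ‖k v‖ₑ)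
      (fun u => ?_) (fun v => ?_) hf.enorm).trans_lt ?_
    · exact (lintegral_sub_left_eq_self (fun v => ‖k v‖ₑ) u).le
    · exact (lintegral_sub_right_eq_self (fun v => ‖k v‖ₑ) v).le
    · exact ENNReal.mul_lt_top (ENNReal.mul_lt_top hki' hki') (lt_top_iff_ne_top.2 hfin)
  have hTP : ∀ u, ‖T u‖ₑ ≤ P u := fun u => by
    refine (enorm_integral_le_lintegral_enorm _).trans (le_of_eq ?_)
    simp only [hP, enorm_mul, mul_comm]
  -- the trilinear integrand
  set g : E2 → E2 × E2 → ℂ := fun u q =>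
    (f q.1 * k (u - q.1)) * conj (f q.2 * k (u - q.2)) with hg
  have hgm : Measurable (Function.uncurry g) := by
    refine Measurable.mul ?_ (hcm.comp ?_)
    · exact ham.comp (f := fun p : E2 × (E2 × E2) => (p.1, p.2.1)) (by fun_prop)
    · exact ham.comp (f := fun p : E2 × (E2 × E2) => (p.1, p.2.2)) (by fun_prop)
  have hgi : Integrable (Function.uncurry g) (volume.prod volume) := by
    refine ⟨hgm.aestronglyMeasurable, ?_⟩
    rw [hasFiniteIntegral_iff_enorm, lintegral_prod _ hgm.enorm.aemeasurable]
    refine lt_of_eq_of_lt ?_ hPfin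
    refine lintegral_congr fun u => ?_
    have h1 : Measurable fun v => ‖f v * k (u - v)‖ₑ :=
      (ham.comp (f := fun v : E2 => (u, v)) (by fun_prop)).enorm
    have h2 : ∀ q : E2 × E2, ‖Function.uncurry g (u, q)‖ₑ
        = ‖f q.1 * k (u - q.1)‖ₑ * ‖f q.2 * k (u - q.2)‖ₑ := fun q => by
      simp [Function.uncurry, hg, enorm_mul]
    simp only [h2]
    rw [Measure.volume_eq_prod, lintegral_prod_mul h1.aemeasurable h1.aemeasurable, sq]
    simp only [hP, enorm_mul, mul_comm]
  have hTT : ∀ u, T u * conj (T u) = ∫ q, g u q := fun u => by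
    simp only [hT, hg]
    rw [← integral_conj, ← integral_prod_mul, Measure.volume_eq_prod]
  have hAval : ∀ q : E2 × E2, ∫ u, g u q =
      f q.1 * conj (f q.2) * ∫ u, k (u + (q.2 - q.1)) * conj (k u) := by
    intro q
    rw [← integral_const_mul, ← integral_add_right_eq_self _ q.2]
    refine integral_congr_ae (Filter.Eventually.of_forall fun u => ?_)
    simp only [hg, map_mul]
    rw [show u + q.2 - q.1 = u + (q.2 - q.1) by abel, show u + q.2 - q.2 = u by abel]
    ring
  set A : E2 → ℝ≥0∞ := fun h => ‖∫ u, k (u + h) * conj (k u)‖ₑ with hAdef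
  have hAm : Measurable A := by
    have : Measurable fun p : E2 × E2 => k (p.2 + p.1) * conj (k p.2) :=
      (hk.comp (by fun_prop)).mul (hcm.comp (hk.comp (by fun_prop)))
    exact this.stronglyMeasurable.integral_prod_right'.measurable.enorm
  have hAm2 : Measurable fun p : E2 × E2 => A (p.2 - p.1) := hAm.comp (by fun_prop)
  have hsq : ∫⁻ u, ‖T u‖ₑ ^ 2 = ‖∫ u, T u * conj (T u)‖ₑ := by
    have h1 : ∀ u, T u * conj (T u) = ((‖T u‖ ^ 2 : ℝ) : ℂ) := fun u => by
      rw [Complex.mul_conj, Complex.normSq_eq_norm_sq]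
    simp only [h1]
    rw [integral_complex_ofReal, ← ofReal_norm, Complex.norm_real,
      Real.norm_of_nonneg (integral_nonneg fun u => by positivity),
      integral_eq_lintegral_of_nonneg_ae (Filter.Eventually.of_forall fun u => by positivity)
        (hTm.norm.pow_const 2).aestronglyMeasurable]
    have h2 : ∀ u, ENNReal.ofReal (‖T u‖ ^ 2) = ‖T u‖ₑ ^ 2 := fun u => by
      rw [ENNReal.ofReal_pow (norm_nonneg _), ofReal_norm]
    simp only [h2]
    rw [ENNReal.ofReal_toReal]
    refine ne_top_of_le_ne_top hPfin.ne (lintegral_mono fun u => ?_)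
    gcongr
    exact hTP u
  set X : ℝ≥0∞ := ∫⁻ v, ‖f v‖ₑ * ∫⁻ v', A (v' - v) * ‖f v'‖ₑ with hX
  have hle : ∫⁻ u, ‖T u‖ₑ ^ 2 ≤ X := by
    rw [hsq]
    simp only [hTT]
    rw [integral_integral_swap hgi]
    refine (enorm_integral_le_lintegral_enorm _).trans (le_of_eq ?_)
    simp only [hAval]
    rw [Measure.volume_eq_prod, lintegral_prod]
    · refine lintegral_congr fun v => ?_
      rw [← lintegral_const_mul]
      · refine lintegral_congr fun v' => ?_
        simp only [enorm_mul, hAdef, RCLike.enorm_conj]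
        ring
      · exact (hAm.comp (by fun_prop)).mul hf.enorm
    · have h3 : Measurable fun p : E2 × E2 => ∫ u, k (u + (p.2 - p.1)) * conj (k u) := by
        have : Measurable fun p : (E2 × E2) × E2 => k (p.2 + (p.1.2 - p.1.1)) * conj (k p.2) :=
          (hk.comp (by fun_prop)).mul (hcm.comp (hk.comp (by fun_prop)))
        exact this.stronglyMeasurable.integral_prod_right'.measurable
      exact (((hf.comp measurable_fst).mul (hcm.comp (hf.comp measurable_snd))).mul
        h3).enorm.aemeasurable
  have hX2 : X ^ 2 ≤ (ENNReal.ofReal N ^ 2 * ∫⁻ v, ‖f v‖ₑ ^ 2) ^ 2 := by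
    have hm : Measurable fun v => ∫⁻ v', A (v' - v) * ‖f v'‖ₑ :=
      Measurable.lintegral_prod_right (f := fun v v' => A (v' - v) * ‖f v'‖ₑ)
        (hAm2.mul (hf.comp measurable_snd).enorm)
    calc X ^ 2 ≤ (∫⁻ v, ‖f v‖ₑ ^ 2) * ∫⁻ v, (∫⁻ v', A (v' - v) * ‖f v'‖ₑ) ^ 2 :=
          sq_lintegral_mul_le hf.enorm.aemeasurable hm.aemeasurable
      _ ≤ (∫⁻ v, ‖f v‖ₑ ^ 2) * (ENNReal.ofReal N ^ 2 * ENNReal.ofReal N ^ 2 *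
            ∫⁻ v, ‖f v‖ₑ ^ 2) := by
          gcongr
          refine lintegral_sq_lintegral_le (k := fun v v' => A (v' - v)) hAm2
            (fun v => ?_) (fun v' => ?_) hf.enorm
          · exact (lintegral_sub_right_eq_self A v).trans_le hA
          · exact (lintegral_sub_left_eq_self A v').trans_le hA
      _ = _ := by ring
  exact hle.trans ((ENNReal.pow_le_pow_left_iff two_ne_zero).1 hX2)

theorem convBound_of_lintegral_le {k : E2 → ℂ} (hk : Measurable k) {N : ℝ}
    (hA : ∫⁻ u, ‖k u‖ₑ ≤ ENNReal.ofReal N) : ConvBound k N := by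
  intro f hf
  have hsm : Measurable fun p : E2 × E2 => k (p.1 - p.2) := hk.comp (by fun_prop)
  calc ∫⁻ u, ‖∫ v, f v * k (u - v)‖ₑ ^ 2
      ≤ ∫⁻ u, (∫⁻ v, ‖k (u - v)‖ₑ * ‖f v‖ₑ) ^ 2 := by
        gcongr with u
        refine (enorm_integral_le_lintegral_enorm _).trans (le_of_eq ?_)
        simp only [enorm_mul, mul_comm]
    _ ≤ ENNReal.ofReal N * ENNReal.ofReal N * ∫⁻ v, ‖f v‖ₑ ^ 2 := by
        refine lintegral_sq_lintegral_le (k := fun u v : E2 => ‖k (u - v)‖ₑ) hsm.enorm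
          (fun u => ?_) (fun v => ?_) hf.enorm
        · exact (lintegral_sub_left_eq_self (fun v => ‖k v‖ₑ) u).trans_le hA
        · exact (lintegral_sub_right_eq_self (fun v => ‖k v‖ₑ) v).trans_le hA
    _ = _ := by ring

/-! ### Iterated directional derivatives at a point -/

section Jets

variable {E : Type*} [NormedAddCommGroup E] [NormedSpace ℝ E]

/-- The derivative of `f` in the direction `h`. -/
noncomputable def dirDeriv (h : E) (f : E → ℝ) : E → ℝ := fun u => fderiv ℝ f u h

/-- The derivatives of `f` at `u` in the direction `h` up to order `n` are those of a function of
size `M` varying at the scale `κ⁻¹`. -/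
def JetLE (h : E) (κ : ℝ) (n : ℕ) (f : E → ℝ) (M : ℝ) (u : E) : Prop :=
  ∀ k ≤ n, |(dirDeriv h)^[k] f u| ≤ M * κ ^ k

variable {h : E} {κ M M' : ℝ} {n : ℕ} {f g : E → ℝ} {u : E}

theorem ContDiff.dirDeriv (hf : ContDiff ℝ (⊤ : ℕ∞) f) (h : E) :
    ContDiff ℝ (⊤ : ℕ∞) (dirDeriv h f) :=
  (hf.fderiv_right (m := (⊤ : ℕ∞)) (by simp)).clm_apply contDiff_const

theorem ContDiff.dirDeriv_iterate (hf : ContDiff ℝ (⊤ : ℕ∞) f) (h : E) (k : ℕ) :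
    ContDiff ℝ (⊤ : ℕ∞) ((_root_.dirDeriv h)^[k] f) := by
  induction k with
  | zero => exact hf
  | succ k ih =>
    rw [Function.iterate_succ_apply']
    exact ih.dirDeriv h

theorem ContDiff.differentiable_top (hf : ContDiff ℝ (⊤ : ℕ∞) f) : Differentiable ℝ f :=
  hf.differentiable (by simp)

theorem dirDeriv_mul (hf : ContDiff ℝ (⊤ : ℕ∞) f) (hg : ContDiff ℝ (⊤ : ℕ∞) g) :
    dirDeriv h (fun x => f x * g x) = fun x => dirDeriv h f x * g x + f x * dirDeriv h g x := by
  ext x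
  unfold dirDeriv
  rw [fderiv_fun_mul (hf.differentiable_top x) (hg.differentiable_top x)]
  simp
  ring

theorem dirDeriv_add (hf : ContDiff ℝ (⊤ : ℕ∞) f) (hg : ContDiff ℝ (⊤ : ℕ∞) g) :
    dirDeriv h (fun x => f x + g x) = fun x => dirDeriv h f x + dirDeriv h g x := by
  ext x
  unfold dirDeriv
  rw [fderiv_fun_add (hf.differentiable_top x) (hg.differentiable_top x)]
  simp

theorem dirDeriv_neg : dirDeriv h (fun x => -f x) = fun x => -dirDeriv h f x := by
  ext x
  unfold dirDeriv
  rw [fderiv_fun_neg]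
  simp

theorem dirDeriv_inv (hf : ContDiff ℝ (⊤ : ℕ∞) f) (h0 : ∀ x, f x ≠ 0) :
    dirDeriv h (fun x => (f x)⁻¹) = fun x => -(dirDeriv h f x * ((f x)⁻¹ * (f x)⁻¹)) := by
  ext x
  unfold dirDeriv
  have := (hasDerivAt_inv (h0 x)).comp_hasFDerivAt x (hf.differentiable_top x).hasFDerivAt
  rw [show fderiv ℝ (fun x => (f x)⁻¹) x = _ from this.fderiv]
  simp
  field_simp

theorem dirDeriv_iterate_translate (f : E → ℝ) (a : E) (k : ℕ) :
    (dirDeriv h)^[k] (fun x => f (x + a)) = fun x => (dirDeriv h)^[k] f (x + a) := by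
  induction k with
  | zero => rfl
  | succ k ih =>
    rw [Function.iterate_succ_apply', Function.iterate_succ_apply', ih]
    ext x
    unfold dirDeriv
    rw [fderiv_comp_add_right]

theorem jetLE_succ_iff : JetLE h κ (n + 1) f M u ↔
    |f u| ≤ M ∧ JetLE h κ n (dirDeriv h f) (M * κ) u := by
  constructor
  · intro hj
    refine ⟨by simpa using hj 0 (by omega), fun k hk => ?_⟩
    have := hj (k + 1) (by omega)
    rw [Function.iterate_succ_apply] at this
    rwa [mul_assoc, ← pow_succ']
  · rintro ⟨h0, h1⟩ k hk
    cases k with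
    | zero => simpa using h0
    | succ k =>
      rw [Function.iterate_succ_apply]
      have := h1 k (by omega)
      rwa [mul_assoc, ← pow_succ'] at this

theorem jetLE_zero_iff : JetLE h κ 0 f M u ↔ |f u| ≤ M := by
  constructor
  · intro hj
    simpa using hj 0 le_rfl
  · intro h0 k hk
    obtain rfl : k = 0 := by omega
    simpa using h0

theorem JetLE.abs_le (hj : JetLE h κ n f M u) : |f u| ≤ M := by simpa using hj 0 (by omega)

theorem JetLE.nonneg (hj : JetLE h κ n f M u) : 0 ≤ M := (abs_nonneg _).trans hj.abs_le

theorem JetLE.of_le {m : ℕ} (hj : JetLE h κ n f M u) (hm : m ≤ n) : JetLE h κ m f M u :=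
  fun k hk => hj k (hk.trans hm)

theorem JetLE.mono (hj : JetLE h κ n f M u) (hκ : 0 ≤ κ) (hM : M ≤ M') :
    JetLE h κ n f M' u :=
  fun k hk => (hj k hk).trans (by gcongr)

theorem JetLE.mono_scale {κ' : ℝ} (hj : JetLE h κ n f M u) (hκ : 0 ≤ κ) (hκ' : κ ≤ κ') :
    JetLE h κ' n f M u :=
  fun k hk => (hj k hk).trans (by have := hj.nonneg; gcongr)

theorem JetLE.neg (hj : JetLE h κ n f M u) : JetLE h κ n (fun x => -f x) M u := by
  induction n generalizing f M with
  | zero => rw [jetLE_zero_iff] at hj ⊢; rwa [abs_neg]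
  | succ n ih =>
    rw [jetLE_succ_iff] at hj ⊢
    rw [abs_neg, dirDeriv_neg]
    exact ⟨hj.1, ih hj.2⟩

theorem JetLE.add (hf : ContDiff ℝ (⊤ : ℕ∞) f) (hg : ContDiff ℝ (⊤ : ℕ∞) g)
    (hjf : JetLE h κ n f M u) (hjg : JetLE h κ n g M' u) :
    JetLE h κ n (fun x => f x + g x) (M + M') u := by
  induction n generalizing f g M M' with
  | zero =>
    rw [jetLE_zero_iff] at *
    exact (abs_add_le _ _).trans (add_le_add hjf hjg)
  | succ n ih =>
    rw [jetLE_succ_iff] at *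
    rw [dirDeriv_add hf hg, add_mul]
    exact ⟨(abs_add_le _ _).trans (add_le_add hjf.1 hjg.1),
      ih (hf.dirDeriv h) (hg.dirDeriv h) hjf.2 hjg.2⟩

theorem JetLE.mul (hκ : 0 ≤ κ) (hf : ContDiff ℝ (⊤ : ℕ∞) f) (hg : ContDiff ℝ (⊤ : ℕ∞) g)
    (hjf : JetLE h κ n f M u) (hjg : JetLE h κ n g M' u) :
    JetLE h κ n (fun x => f x * g x) (2 ^ n * (M * M')) u := by
  induction n generalizing f g M M' with
  | zero =>
    rw [jetLE_zero_iff] at *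
    rw [abs_mul, pow_zero, one_mul]
    exact mul_le_mul hjf hjg (abs_nonneg _) ((abs_nonneg _).trans hjf)
  | succ n ih =>
    have hM := hjf.nonneg
    have hM' := hjg.nonneg
    have h1 := hjf.of_le (Nat.le_succ n)
    have h2 := hjg.of_le (Nat.le_succ n)
    rw [jetLE_succ_iff] at *
    refine ⟨?_, ?_⟩
    · rw [abs_mul]
      calc |f u| * |g u| ≤ M * M' := mul_le_mul hjf.1 hjg.1 (abs_nonneg _) hM
        _ ≤ 2 ^ (n + 1) * (M * M') :=
          le_mul_of_one_le_left (by positivity) (one_le_pow₀ (by norm_num))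
    · rw [dirDeriv_mul hf hg]
      refine ((ih (hf.dirDeriv h) hg hjf.2 h2).add ((hf.dirDeriv h).mul hg)
        (hf.mul (hg.dirDeriv h)) (ih hf (hg.dirDeriv h) h1 hjg.2)).mono hκ (le_of_eq ?_)
      ring

/-- The constant in the estimate of the derivatives of a reciprocal, `JetLE.inv`. -/
noncomputable def invJetConst (L : ℝ) : ℕ → ℝ
  | 0 => 1
  | n + 1 => 1 + 4 ^ n * L * invJetConst L n ^ 2

theorem one_le_invJetConst {L : ℝ} (hL : 0 ≤ L) (n : ℕ) : 1 ≤ invJetConst L n := by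
  cases n with
  | zero => exact le_rfl
  | succ n =>
    unfold invJetConst
    have : 0 ≤ 4 ^ n * L * invJetConst L n ^ 2 := by positivity
    linarith

/-- Derivatives of a reciprocal: if `f` is bounded below by `c` at `u` and comparable to `c` in the
sense of jets, then `1 / f` is comparable to `1 / c`. -/
theorem JetLE.inv {L c : ℝ} (hκ : 0 ≤ κ) (hf : ContDiff ℝ (⊤ : ℕ∞) f) (h0 : ∀ x, f x ≠ 0)
    (hc : 0 < c) (hcf : c ≤ f u) (hj : JetLE h κ n f (L * c) u) :
    JetLE h κ n (fun x => (f x)⁻¹) (invJetConst L n / c) u := by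
  have hL : 0 ≤ L := nonneg_of_mul_nonneg_left hj.nonneg hc
  have hle : |(f u)⁻¹| ≤ 1 / c := by
    rw [abs_of_nonneg (inv_nonneg.2 (hc.le.trans hcf)), one_div]
    exact inv_anti₀ hc hcf
  have hfi : ContDiff ℝ (⊤ : ℕ∞) fun x => (f x)⁻¹ := hf.inv h0
  induction n with
  | zero => rw [jetLE_zero_iff]; exact hle
  | succ n ih =>
    have h1 := ih (hj.of_le (Nat.le_succ n))
    rw [jetLE_succ_iff] at hj ⊢
    refine ⟨hle.trans ?_, ?_⟩
    · gcongr
      exact one_le_invJetConst hL _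
    · rw [dirDeriv_inv hf h0]
      refine ((JetLE.mul hκ (hf.dirDeriv h) (hfi.mul hfi) hj.2
        (JetLE.mul hκ hfi hfi h1 h1)).neg).mono hκ ?_
      calc 2 ^ n * (L * c * κ * (2 ^ n * (invJetConst L n / c * (invJetConst L n / c))))
          = (4 ^ n * L * invJetConst L n ^ 2) / c * κ := by
            rw [show (4 : ℝ) ^ n = 2 ^ n * 2 ^ n by rw [← mul_pow]; norm_num]
            field_simp
        _ ≤ invJetConst L (n + 1) / c * κ := by
            gcongr
            rw [invJetConst]
            linarith

theorem jetLE_translate (a : E) :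
    JetLE h κ n (fun x => f (x + a)) M u ↔ JetLE h κ n f M (u + a) := by
  simp only [JetLE, dirDeriv_iterate_translate]

theorem hasDerivAt_line (hf : ContDiff ℝ (⊤ : ℕ∞) f) (u h : E) (s : ℝ) :
    HasDerivAt (fun s : ℝ => f (u + s • h)) (dirDeriv h f (u + s • h)) s := by
  have h1 : HasDerivAt (fun s : ℝ => u + s • h) h s := by
    simpa using ((hasDerivAt_id s).smul_const h).const_add u
  exact (hf.differentiable_top _).hasFDerivAt.comp_hasDerivAt s h1

theorem exists_dirDeriv_eq_sub (hf : ContDiff ℝ (⊤ : ℕ∞) f) (u h : E) :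
    ∃ s ∈ Set.Ioo (0 : ℝ) 1, f (u + h) - f u = dirDeriv h f (u + s • h) := by
  obtain ⟨s, hs, hs'⟩ := exists_hasDerivAt_eq_slope (fun s : ℝ => f (u + s • h))
    (fun s => dirDeriv h f (u + s • h)) zero_lt_one
    (fun s _ => (hasDerivAt_line hf u h s).continuousAt.continuousWithinAt)
    (fun s _ => hasDerivAt_line hf u h s)
  exact ⟨s, hs, by simpa using hs'.symm⟩

/-- The derivatives of a difference `f (· + h) - f` are controlled, by the mean value theorem, by
those of the derivative of `f` along the segment. -/
theorem JetLE.sub_translate (hf : ContDiff ℝ (⊤ : ℕ∞) f)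
    (hj : ∀ s ∈ Set.Ioo (0 : ℝ) 1, JetLE h κ n (dirDeriv h f) M (u + s • h)) :
    JetLE h κ n (fun x => f (x + h) - f x) M u := by
  have hsub : ∀ k, (dirDeriv h)^[k] (fun x => f (x + h) - f x)
      = fun x => (dirDeriv h)^[k] f (x + h) - (dirDeriv h)^[k] f x := by
    intro k
    induction k with
    | zero => rfl
    | succ k ih =>
      rw [Function.iterate_succ_apply', Function.iterate_succ_apply', ih]
      ext x
      have hk := hf.dirDeriv_iterate h k
      unfold dirDeriv at hk ⊢
      rw [fderiv_fun_sub, fderiv_comp_add_right]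
      · simp
      · exact (hk.comp (contDiff_id.add contDiff_const)).differentiable_top x
      · exact hk.differentiable_top x
  intro k hk
  obtain ⟨s, hs, hs'⟩ := exists_dirDeriv_eq_sub (hf.dirDeriv_iterate h k) u h
  rw [hsub]
  simp only
  rw [hs', ← Function.iterate_succ_apply' (dirDeriv h), Function.iterate_succ_apply]
  exact hj s hs k hk

/-! ### Nonstationary phase -/

/-- The amplitude produced by one integration by parts in the direction `h`, when the derivative
of the phase is `q`. -/
noncomputable def ibpStep (h : E) (q A : E → ℝ) : E → ℝ := dirDeriv h fun x => A x * (q x)⁻¹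

variable {q A : E → ℝ}

theorem ContDiff.ibpStep (hA : ContDiff ℝ (⊤ : ℕ∞) A) (hq : ContDiff ℝ (⊤ : ℕ∞) q)
    (h0 : ∀ x, q x ≠ 0) (h : E) : ContDiff ℝ (⊤ : ℕ∞) (ibpStep h q A) :=
  (hA.mul (hq.inv h0)).dirDeriv h

theorem HasCompactSupport.ibpStep (hA : HasCompactSupport A) (h : E) (q : E → ℝ) :
    HasCompactSupport (ibpStep h q A) :=
  HasCompactSupport.fderiv_apply (𝕜 := ℝ) (hA.mul_right (f' := fun x => (q x)⁻¹)) h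

theorem ibpStep_eventually_eq_zero (hA : ∀ᶠ x in nhds u, A x = 0) (h : E) (q : E → ℝ) :
    ∀ᶠ x in nhds u, ibpStep h q A x = 0 := by
  have h1 : (fun x => A x * (q x)⁻¹) =ᶠ[nhds u] fun _ => 0 := by
    filter_upwards [hA] with x hx
    simp [hx]
  filter_upwards [h1.fderiv (𝕜 := ℝ)] with x hx
  unfold ibpStep dirDeriv
  rw [hx]
  simp

theorem JetLE.ibpStep {D : ℝ} (hκ : 0 ≤ κ) (hA : ContDiff ℝ (⊤ : ℕ∞) A)
    (hq : ContDiff ℝ (⊤ : ℕ∞) q) (h0 : ∀ x, q x ≠ 0)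
    (hjA : JetLE h κ (n + 1) A M u) (hjq : JetLE h κ (n + 1) (fun x => (q x)⁻¹) D u) :
    JetLE h κ n (ibpStep h q A) (2 ^ (n + 1) * (M * D) * κ) u :=
  (jetLE_succ_iff.1 (JetLE.mul hκ hA (hq.inv h0) hjA hjq)).2

variable [FiniteDimensional ℝ E] [MeasurableSpace E] [BorelSpace E] {μ : Measure E}
  [μ.IsAddHaarMeasure]

/-- One integration by parts in the direction `h`. -/
theorem norm_integral_exp_mul_eq {ψ : E → ℝ} {lam : ℝ} (hlam : 0 < lam)
    (hψ : ContDiff ℝ (⊤ : ℕ∞) ψ) (h0 : ∀ x, dirDeriv h ψ x ≠ 0)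
    (hA : ContDiff ℝ (⊤ : ℕ∞) A) (hAs : HasCompactSupport A) :
    ‖∫ x, Complex.exp (Complex.I * ((lam * ψ x : ℝ) : ℂ)) * (A x : ℂ) ∂μ‖ =
      lam⁻¹ * ‖∫ x, Complex.exp (Complex.I * ((lam * ψ x : ℝ) : ℂ)) *
        (ibpStep h (dirDeriv h ψ) A x : ℂ) ∂μ‖ := by
  set q := dirDeriv h ψ with hq
  have hqs : ContDiff ℝ (⊤ : ℕ∞) q := hψ.dirDeriv h
  set G : E → ℝ := fun x => A x * (q x)⁻¹ with hG
  have hGs : ContDiff ℝ (⊤ : ℕ∞) G := hA.mul (hqs.inv h0)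
  have hGc : HasCompactSupport G := hAs.mul_right
  set e : E → ℂ := fun x => Complex.exp (Complex.I * ((lam * ψ x : ℝ) : ℂ)) with he
  have hec : Continuous e := by
    have := hψ.continuous
    fun_prop
  have hof : ∀ {b : E → ℝ}, HasCompactSupport b → HasCompactSupport fun x => (b x : ℂ) :=
    fun hb => hb.comp_left (g := ((↑) : ℝ → ℂ)) Complex.ofReal_zero
  have hint : ∀ {b : E → ℝ}, Continuous b → HasCompactSupport b →
      Integrable (fun x => e x * (b x : ℂ)) μ := fun hb hbs =>
    (hec.mul (Complex.continuous_ofReal.comp hb)).integrable_of_hasCompactSupport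
      (HasCompactSupport.mul_left (hof hbs))
  have hederiv : ∀ x, HasLineDerivAt ℝ e (Complex.I * (lam * q x : ℝ) * e x) x h := by
    intro x
    have h1 : HasDerivAt (fun s : ℝ => ψ (x + s • h)) (q x) 0 := by
      simpa using hasDerivAt_line hψ x h 0
    have h2 := ((((h1.const_mul lam).ofReal_comp).const_mul Complex.I).cexp)
    have h3 : Complex.I * (lam * q x : ℝ) * e x =
        Complex.exp (Complex.I * ((lam * ψ (x + (0 : ℝ) • h) : ℝ) : ℂ)) *
          (Complex.I * ((lam * q x : ℝ) : ℂ)) := by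
      simp only [he, zero_smul, add_zero]
      ring
    rw [h3]
    exact h2
  have hGderiv : ∀ x, HasLineDerivAt ℝ (fun x => (G x : ℂ)) ((ibpStep h q A x : ℝ) : ℂ) x h := by
    intro x
    have h1 : HasDerivAt (fun s : ℝ => G (x + s • h)) (ibpStep h q A x) 0 := by
      have := hasDerivAt_line hGs x h 0
      rwa [zero_smul, add_zero] at this
    exact h1.ofReal_comp
  have key := integral_bilinear_hasLineDerivAt_right_eq_neg_left_of_integrable (μ := μ)
    (B := ContinuousLinearMap.mul ℝ ℂ) (f := e) (f' := fun x => Complex.I * (lam * q x : ℝ) * e x)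
    (g := fun x => (G x : ℂ)) (g' := fun x => ((ibpStep h q A x : ℝ) : ℂ)) (v := h)
    ?_ ?_ ?_ (fun x _ => hederiv x) (fun x _ => hGderiv x)
  · simp only [ContinuousLinearMap.mul_apply'] at key
    have h3 : ∀ x, Complex.I * (lam * q x : ℝ) * e x * (G x : ℂ) =
        (Complex.I * lam) * (e x * (A x : ℂ)) := fun x => by
      have : (q x : ℂ) ≠ 0 := by exact_mod_cast h0 x
      simp only [hG]
      push_cast
      field_simp
    simp only [h3] at key
    rw [integral_const_mul] at key
    rw [key, norm_neg, norm_mul, norm_mul, Complex.norm_I, one_mul, Complex.norm_real,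
      Real.norm_of_nonneg hlam.le, ← mul_assoc, inv_mul_cancel₀ hlam.ne', one_mul]
  · have := (hint (b := fun x => q x * G x) (hqs.continuous.mul hGs.continuous)
      hGc.mul_left).const_mul (Complex.I * lam)
    refine this.congr (Filter.Eventually.of_forall fun x => ?_)
    simp only [ContinuousLinearMap.mul_apply']
    push_cast
    ring
  · exact hint (hA.ibpStep hqs h0 h).continuous (hAs.ibpStep h q)
  · exact hint hGs.continuous hGc

/-- Three integrations by parts. -/
theorem norm_integral_exp_mul_le {ψ : E → ℝ} {lam : ℝ} (hlam : 0 < lam)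
    (hψ : ContDiff ℝ (⊤ : ℕ∞) ψ) (h0 : ∀ x, dirDeriv h ψ x ≠ 0)
    (hA : ContDiff ℝ (⊤ : ℕ∞) A) (hAs : HasCompactSupport A) {S : Set E} (hS : IsClosed S)
    (hSA : ∀ x, x ∉ S → A x = 0) (hSμ : μ S ≠ ∞) {D : ℝ} (hκ : 0 ≤ κ)
    (hjA : ∀ x ∈ S, JetLE h κ 3 A M x)
    (hjq : ∀ x ∈ S, JetLE h κ 3 (fun x => (dirDeriv h ψ x)⁻¹) D x) :
    ‖∫ x, Complex.exp (Complex.I * ((lam * ψ x : ℝ) : ℂ)) * (A x : ℂ) ∂μ‖ ≤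
      64 * M * (D * κ / lam) ^ 3 * μ.real S := by
  have hqs : ContDiff ℝ (⊤ : ℕ∞) (dirDeriv h ψ) := hψ.dirDeriv h
  set st := ibpStep h (dirDeriv h ψ) with hst
  have hA1 : ContDiff ℝ (⊤ : ℕ∞) (st A) := hA.ibpStep hqs h0 h
  have hA2 : ContDiff ℝ (⊤ : ℕ∞) (st (st A)) := hA1.ibpStep hqs h0 h
  have hzero : ∀ x, x ∉ S → st (st (st A)) x = 0 := by
    intro x hx
    have : ∀ᶠ y in nhds x, A y = 0 := by
      filter_upwards [hS.isOpen_compl.mem_nhds hx] with y hy using hSA y hy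
    exact (ibpStep_eventually_eq_zero (ibpStep_eventually_eq_zero
      (ibpStep_eventually_eq_zero this h _) h _) h _).self_of_nhds
  have hbound : ∀ x ∈ S, ‖Complex.exp (Complex.I * ((lam * ψ x : ℝ) : ℂ)) *
      (st (st (st A)) x : ℂ)‖ ≤ 64 * M * (D * κ) ^ 3 := by
    intro x hx
    have hq3 := hjq x hx
    have h1 := (hjA x hx).ibpStep (n := 2) hκ hA hqs h0 hq3
    have h2 := h1.ibpStep (n := 1) hκ hA1 hqs h0 (hq3.of_le (by norm_num))
    have h3 := (h2.ibpStep (n := 0) hκ hA2 hqs h0 (hq3.of_le (by norm_num))).abs_le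
    rw [norm_mul, mul_comm Complex.I, Complex.norm_exp_ofReal_mul_I, one_mul, Complex.norm_real]
    refine h3.trans (le_of_eq ?_)
    ring
  have hset : ∫ x, Complex.exp (Complex.I * ((lam * ψ x : ℝ) : ℂ)) * (st (st (st A)) x : ℂ) ∂μ =
      ∫ x in S, Complex.exp (Complex.I * ((lam * ψ x : ℝ) : ℂ)) * (st (st (st A)) x : ℂ) ∂μ := by
    refine (setIntegral_eq_integral_of_forall_compl_eq_zero fun x hx => ?_).symm
    rw [hzero x hx]
    simp
  rw [norm_integral_exp_mul_eq hlam hψ h0 hA hAs,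
    norm_integral_exp_mul_eq hlam hψ h0 hA1 (hAs.ibpStep h _),
    norm_integral_exp_mul_eq hlam hψ h0 hA2 ((hAs.ibpStep h _).ibpStep h _), hset]
  have := norm_setIntegral_le_of_norm_le_const hSμ.lt_top hbound
  calc lam⁻¹ * (lam⁻¹ * (lam⁻¹ * ‖∫ x in S, Complex.exp (Complex.I * ((lam * ψ x : ℝ) : ℂ)) *
        (st (st (st A)) x : ℂ) ∂μ‖))
      ≤ lam⁻¹ * (lam⁻¹ * (lam⁻¹ * (64 * M * (D * κ) ^ 3 * μ.real S))) := by gcongr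
    _ = _ := by rw [div_pow]; field_simp

end Jets

/-! ### The phase on a slice of the cone -/

/-- The distance to the origin of the point at height `t` and transverse position `u`. -/
noncomputable def sliceNorm (t : ℝ) (u : E2) : ℝ := Real.sqrt (t ^ 2 + ‖u‖ ^ 2)

section Phase

variable {t : ℝ} {κ M M' : ℝ} {n : ℕ} {h u : E2}

theorem sliceNorm_sq (t : ℝ) (u : E2) : sliceNorm t u ^ 2 = t ^ 2 + ‖u‖ ^ 2 :=
  Real.sq_sqrt (by positivity)

theorem le_sliceNorm (t : ℝ) (u : E2) : t ≤ sliceNorm t u :=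
  Real.le_sqrt_of_sq_le (by nlinarith [sq_nonneg ‖u‖])

theorem norm_le_sliceNorm (t : ℝ) (u : E2) : ‖u‖ ≤ sliceNorm t u :=
  Real.le_sqrt_of_sq_le (by nlinarith [sq_nonneg t])

theorem sliceNorm_pos (ht : 0 < t) (u : E2) : 0 < sliceNorm t u := ht.trans_le (le_sliceNorm t u)

theorem contDiff_sliceNorm (ht : 0 < t) : ContDiff ℝ (⊤ : ℕ∞) (sliceNorm t) := by
  unfold sliceNorm
  exact (contDiff_const.add (contDiff_norm_sq ℝ)).sqrt fun u => by positivity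

theorem contDiff_inner_right (h : E2) : ContDiff ℝ (⊤ : ℕ∞) fun u : E2 => inner ℝ u h :=
  contDiff_id.inner ℝ contDiff_const

theorem dirDeriv_inner (h : E2) : dirDeriv h (fun u : E2 => inner ℝ u h) = fun _ => ‖h‖ ^ 2 := by
  ext u
  unfold dirDeriv
  rw [fderiv_inner_apply ℝ differentiableAt_fun_id (differentiableAt_const h)]
  simp

theorem dirDeriv_sliceNorm (ht : 0 < t) (h : E2) :
    dirDeriv h (sliceNorm t) = fun u => inner ℝ u h * (sliceNorm t u)⁻¹ := by
  ext u
  have h1 : HasFDerivAt (fun u : E2 => t ^ 2 + ‖u‖ ^ 2) (2 • (innerSL ℝ u)) u :=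
    ((hasStrictFDerivAt_norm_sq u).hasFDerivAt).const_add _
  have h2 := h1.sqrt (by positivity)
  unfold dirDeriv
  rw [show fderiv ℝ (sliceNorm t) u = _ from h2.fderiv]
  have : Real.sqrt (t ^ 2 + ‖u‖ ^ 2) ≠ 0 := (sliceNorm_pos ht u).ne'
  simp [sliceNorm]
  field_simp

theorem dirDeriv_const (h : E2) (c : ℝ) : dirDeriv h (fun _ : E2 => c) = fun _ => 0 := by
  ext u
  simp [dirDeriv]

theorem jetLE_const {c : ℝ} (hκ : 0 ≤ κ) (hc : |c| ≤ M) : JetLE h κ n (fun _ => c) M u := by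
  induction n generalizing c M with
  | zero => rwa [jetLE_zero_iff]
  | succ n ih =>
    rw [jetLE_succ_iff, dirDeriv_const]
    have : 0 ≤ M := (abs_nonneg _).trans hc
    exact ⟨hc, ih (by simp; positivity)⟩

theorem jetLE_inner (ht : 0 < t) (hu : sliceNorm t u ≤ 2 * t) :
    JetLE h (‖h‖ / t) n (fun u => inner ℝ u h) (2 * t * ‖h‖) u := by
  have h0 : |(inner ℝ u h : ℝ)| ≤ 2 * t * ‖h‖ := by
    refine (abs_real_inner_le_norm u h).trans ?_
    gcongr
    exact (norm_le_sliceNorm t u).trans hu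
  cases n with
  | zero => rwa [jetLE_zero_iff]
  | succ n =>
    rw [jetLE_succ_iff, dirDeriv_inner]
    refine ⟨h0, jetLE_const (by positivity) ?_⟩
    rw [abs_of_nonneg (by positivity)]
    have : 2 * t * ‖h‖ * (‖h‖ / t) = 2 * ‖h‖ ^ 2 := by field_simp
    nlinarith [sq_nonneg ‖h‖]

/-- On the cone, the distance to the origin varies at the scale of the height. -/
theorem exists_jetLE_sliceNorm (n : ℕ) : ∃ L : ℝ, 0 ≤ L ∧ ∀ t : ℝ, 0 < t → ∀ h u : E2,
    sliceNorm t u ≤ 2 * t → JetLE h (‖h‖ / t) n (sliceNorm t) (L * t) u := by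
  have habs : ∀ {t : ℝ} {u : E2}, 0 < t → sliceNorm t u ≤ 2 * t → |sliceNorm t u| ≤ 2 * t :=
    fun ht hu => by rwa [abs_of_pos (sliceNorm_pos ht _)]
  induction n with
  | zero =>
    exact ⟨2, by norm_num, fun t ht h u hu => jetLE_zero_iff.2 (habs ht hu)⟩
  | succ n ih =>
    obtain ⟨L, hL, hj⟩ := ih
    have hD := one_le_invJetConst hL n
    refine ⟨2 + 2 ^ n * 2 * invJetConst L n, by positivity, fun t ht h u hu => ?_⟩
    have hs := contDiff_sliceNorm ht
    have hne : ∀ x, sliceNorm t x ≠ 0 := fun x => (sliceNorm_pos ht x).ne'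
    rw [jetLE_succ_iff, dirDeriv_sliceNorm ht]
    refine ⟨(habs ht hu).trans ?_, ?_⟩
    · gcongr
      have : 0 ≤ 2 ^ n * 2 * invJetConst L n := by positivity
      linarith
    · refine (JetLE.mul (by positivity) (contDiff_inner_right h) (hs.inv hne) (jetLE_inner ht hu)
        ((hj t ht h u hu).inv (by positivity) hs hne ht (le_sliceNorm t u))).mono
        (by positivity) ?_
      have : 2 ^ n * (2 * t * ‖h‖ * (invJetConst L n / t)) =
          2 ^ n * 2 * invJetConst L n * t * (‖h‖ / t) := by field_simp
      rw [this]
      gcongr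
      linarith

/-- Lower bound for the second derivative of the phase in the direction `h`. -/
theorem le_dirDeriv_dirDeriv_sliceNorm (ht : 0 < t) (h u : E2) :
    ‖h‖ ^ 2 * t ^ 2 / sliceNorm t u ^ 3 ≤ dirDeriv h (dirDeriv h (sliceNorm t)) u := by
  have hs := contDiff_sliceNorm ht
  have hne : ∀ x, sliceNorm t x ≠ 0 := fun x => (sliceNorm_pos ht x).ne'
  have hpos := sliceNorm_pos ht u
  have heq : dirDeriv h (dirDeriv h (sliceNorm t)) u =
      (‖h‖ ^ 2 * sliceNorm t u ^ 2 - (inner ℝ u h : ℝ) ^ 2) / sliceNorm t u ^ 3 := by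
    rw [dirDeriv_sliceNorm ht, dirDeriv_mul (g := fun x => (sliceNorm t x)⁻¹)
        (contDiff_inner_right h) (hs.inv hne),
      dirDeriv_inner,
      dirDeriv_inv hs hne, dirDeriv_sliceNorm ht]
    field_simp
    ring
  rw [heq, sliceNorm_sq]
  gcongr
  have h1 : (inner ℝ u h : ℝ) ^ 2 ≤ (‖u‖ * ‖h‖) ^ 2 :=
    sq_le_sq' (neg_le_of_abs_le (abs_real_inner_le_norm u h)) (real_inner_le_norm u h)
  nlinarith

/-- The phase of the autocorrelation of a slice. -/
noncomputable def phaseDiff (t : ℝ) (h u : E2) : ℝ := sliceNorm t (u + h) - sliceNorm t u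

theorem contDiff_translate {f : E2 → ℝ} (hf : ContDiff ℝ (⊤ : ℕ∞) f) (h : E2) :
    ContDiff ℝ (⊤ : ℕ∞) fun u => f (u + h) :=
  hf.comp (contDiff_id.add contDiff_const)

theorem contDiff_phaseDiff (ht : 0 < t) (h : E2) : ContDiff ℝ (⊤ : ℕ∞) (phaseDiff t h) :=
  (contDiff_translate (contDiff_sliceNorm ht) h).sub (contDiff_sliceNorm ht)

theorem dirDeriv_phaseDiff (ht : 0 < t) (h : E2) : dirDeriv h (phaseDiff t h) =
    fun u => dirDeriv h (sliceNorm t) (u + h) - dirDeriv h (sliceNorm t) u := by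
  ext u
  have hs := contDiff_sliceNorm ht
  unfold dirDeriv phaseDiff
  rw [fderiv_fun_sub ((contDiff_translate hs h).differentiable_top u) (hs.differentiable_top u),
    fderiv_comp_add_right]
  simp

theorem exists_le_dirDeriv_phaseDiff (ht : 0 < t) (h u : E2) : ∃ s ∈ Set.Ioo (0 : ℝ) 1,
    ‖h‖ ^ 2 * t ^ 2 / sliceNorm t (u + s • h) ^ 3 ≤ dirDeriv h (phaseDiff t h) u := by
  obtain ⟨s, hs, hs'⟩ := exists_dirDeriv_eq_sub ((contDiff_sliceNorm ht).dirDeriv h) u h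
  refine ⟨s, hs, ?_⟩
  rw [dirDeriv_phaseDiff ht]
  simp only
  rw [hs']
  exact le_dirDeriv_dirDeriv_sliceNorm ht h _

theorem dirDeriv_phaseDiff_pos (ht : 0 < t) (hh : h ≠ 0) (u : E2) :
    0 < dirDeriv h (phaseDiff t h) u := by
  obtain ⟨s, -, hs⟩ := exists_le_dirDeriv_phaseDiff ht h u
  have := sliceNorm_pos ht (u + s • h)
  have := norm_pos_iff.2 hh
  exact lt_of_lt_of_le (by positivity) hs

theorem sliceNorm_segment_le {R : ℝ} (hu : sliceNorm t u ≤ R)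
    (huh : sliceNorm t (u + h) ≤ R) {s : ℝ} (hs : s ∈ Set.Ioo (0 : ℝ) 1) :
    sliceNorm t (u + s • h) ≤ R := by
  have hR : 0 ≤ R := (Real.sqrt_nonneg _).trans hu
  unfold sliceNorm at *
  rw [Real.sqrt_le_left hR] at *
  have h1 : ‖u + s • h‖ ≤ max ‖u‖ ‖u + h‖ := by
    have h2 : u + s • h = (1 - s) • u + s • (u + h) := by
      rw [smul_add, sub_smul, one_smul]; abel
    rw [h2]
    refine (norm_add_le _ _).trans ?_
    rw [norm_smul, norm_smul, Real.norm_of_nonneg (by linarith [hs.2]),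
      Real.norm_of_nonneg hs.1.le]
    nlinarith [le_max_left ‖u‖ ‖u + h‖, le_max_right ‖u‖ ‖u + h‖, hs.1, hs.2]
  rcases le_max_iff.1 h1 with h2 | h2
  · have : ‖u + s • h‖ ^ 2 ≤ ‖u‖ ^ 2 := by gcongr
    linarith
  · have : ‖u + s • h‖ ^ 2 ≤ ‖u + h‖ ^ 2 := by gcongr
    linarith

/-- The reciprocal of the derivative of the phase has size `t / |h|²` and varies at the scale of the
height. -/
theorem exists_jetLE_inv_dirDeriv_phaseDiff : ∃ D : ℝ, 0 < D ∧ ∀ t : ℝ, 0 < t → ∀ h u : E2,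
    h ≠ 0 → sliceNorm t u ≤ 2 * t → sliceNorm t (u + h) ≤ 2 * t → ∀ κ : ℝ, ‖h‖ / t ≤ κ →
    JetLE h κ 3 (fun x => (dirDeriv h (phaseDiff t h) x)⁻¹) (D * t / ‖h‖ ^ 2) u := by
  obtain ⟨L, hL, hj⟩ := exists_jetLE_sliceNorm 5
  have hD := one_le_invJetConst (L := 8 * L) (by positivity) 3
  refine ⟨8 * invJetConst (8 * L) 3, by positivity, fun t ht h u hh hu huh κ hκ => ?_⟩
  have hs := contDiff_sliceNorm ht
  have hhpos := norm_pos_iff.2 hh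
  have hκ0 : 0 ≤ ‖h‖ / t := by positivity
  have hlow : ‖h‖ ^ 2 / (8 * t) ≤ dirDeriv h (phaseDiff t h) u := by
    obtain ⟨s, hs, hs'⟩ := exists_le_dirDeriv_phaseDiff ht h u
    refine le_trans ?_ hs'
    have h1 := sliceNorm_segment_le hu huh hs
    have h2 := sliceNorm_pos ht (u + s • h)
    calc ‖h‖ ^ 2 / (8 * t) = ‖h‖ ^ 2 * t ^ 2 / (2 * t) ^ 3 := by field_simp; ring
      _ ≤ _ := by gcongr
  have hjq : JetLE h κ 3 (dirDeriv h (phaseDiff t h)) (8 * L * (‖h‖ ^ 2 / (8 * t))) u := by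
    refine JetLE.mono_scale ?_ hκ0 hκ
    rw [dirDeriv_phaseDiff ht]
    refine JetLE.sub_translate (hs.dirDeriv h) fun s hs' => ?_
    have h5 := hj t ht h _ (sliceNorm_segment_le hu huh hs')
    refine (jetLE_succ_iff.1 (jetLE_succ_iff.1 h5).2).2.mono hκ0 (le_of_eq ?_)
    field_simp
  refine (hjq.inv (hκ0.trans hκ) ((contDiff_phaseDiff ht h).dirDeriv h)
    (fun x => (dirDeriv_phaseDiff_pos ht hh x).ne') (by positivity) hlow).mono (hκ0.trans hκ)
    (le_of_eq ?_)
  field_simp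

end Phase

/-! ### The autocorrelation of a slice -/

/-- The set of transverse positions at height `t` allowed in the cone of opening `δ`. -/
def sliceSet (t δ : ℝ) : Set E2 := {u | sliceNorm t u ≤ 2 * t ∧ ‖u‖ ≤ 2 * (δ * t)}

theorem isClosed_sliceSet {t : ℝ} (δ : ℝ) : IsClosed (sliceSet t δ) := by
  have : Continuous (sliceNorm t) := by unfold sliceNorm; fun_prop
  exact (isClosed_le this continuous_const).inter (isClosed_le continuous_norm continuous_const)

theorem sliceSet_subset (t δ : ℝ) : sliceSet t δ ⊆ Metric.closedBall 0 (2 * (δ * t)) :=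
  fun u hu => by simpa using hu.2

theorem isCompact_sliceSet {t : ℝ} (δ : ℝ) : IsCompact (sliceSet t δ) :=
  (isCompact_closedBall (0 : E2) (2 * (δ * t))).of_isClosed_subset (isClosed_sliceSet δ)
    (sliceSet_subset t δ)

theorem exists_volume_real_sliceSet_le : ∃ c : ℝ, 0 < c ∧ ∀ t δ : ℝ, 0 ≤ t → 0 ≤ δ →
    volume.real (sliceSet t δ) ≤ c * (δ * t) ^ 2 := by
  refine ⟨4 * volume.real (Metric.ball (0 : E2) 1), ?_, fun t δ ht hδ => ?_⟩
  · have : 0 < volume.real (Metric.ball (0 : E2) 1) :=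
      ENNReal.toReal_pos (Metric.measure_ball_pos volume _ one_pos).ne' measure_ball_lt_top.ne
    positivity
  · calc volume.real (sliceSet t δ) ≤ volume.real (Metric.closedBall (0 : E2) (2 * (δ * t))) :=
          measureReal_mono (sliceSet_subset t δ) measure_closedBall_lt_top.ne
      _ = (2 * (δ * t)) ^ 2 * volume.real (Metric.ball (0 : E2) 1) := by
          unfold Measure.real
          rw [Measure.addHaar_closedBall _ _ (by positivity), ENNReal.toReal_mul,
            ENNReal.toReal_ofReal (by positivity)]
          simp
      _ = _ := by ring

/-- An amplitude on the slice at height `t` of the cone of opening `δ`: a smooth function of size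
`M / t` supported in the slice and varying at the scale `δ t`. -/
structure IsSliceAmplitude (t δ M : ℝ) (b : E2 → ℝ) : Prop where
  contDiff : ContDiff ℝ (⊤ : ℕ∞) b
  support_subset : ∀ u, u ∉ sliceSet t δ → b u = 0
  jetLE : ∀ h u, u ∈ sliceSet t δ → JetLE h (‖h‖ / (δ * t)) 3 b (M / t) u

/-- Merges the trivial bound, useful for `y ≤ 1`, with the decay `y⁻³` obtained from integration by
parts. -/
theorem inv_cube_bound {X y C : ℝ} (hX : 0 ≤ X) (hC : 0 ≤ C) (hy : 0 ≤ y) {I : ℝ} (h1 : I ≤ X)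
    (h2 : 0 < y → I ≤ X * (C * (y⁻¹) ^ 3)) : I ≤ 8 * (1 + C) * X * ((1 + y) ^ 3)⁻¹ := by
  by_cases hy1 : y ≤ 1
  · have h3 : (1 + y) ^ 3 ≤ 2 ^ 3 := by gcongr; linarith
    have h4 : 1 ≤ 8 * ((1 + y) ^ 3)⁻¹ := by
      rw [← div_eq_mul_inv, one_le_div (by positivity)]; linarith
    calc I ≤ X * 1 * 1 := by linarith
      _ ≤ X * (1 + C) * (8 * ((1 + y) ^ 3)⁻¹) := by gcongr; linarith
      _ = _ := by ring
  · have hy0 : 0 < y := by linarith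
    have h3 : (1 + y) ^ 3 ≤ (2 * y) ^ 3 := by gcongr; linarith
    have h4 : (y⁻¹) ^ 3 ≤ 8 * ((1 + y) ^ 3)⁻¹ := by
      rw [← div_eq_mul_inv, inv_pow, le_div_iff₀ (by positivity), inv_mul_le_iff₀ (by positivity)]
      linarith
    calc I ≤ X * (C * (y⁻¹) ^ 3) := h2 hy0
      _ ≤ X * ((1 + C) * (8 * ((1 + y) ^ 3)⁻¹)) := by gcongr; linarith
      _ = _ := by ring

/-- Decay of the autocorrelation of a slice. The height `t` drops out: the amplitude squared is
`M² t⁻²`, the area is of order `(δ t)²`, and each integration by parts gains `(λ δ |h|)⁻¹`. -/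
theorem exists_norm_autocorrelation_le : ∃ C : ℝ, 0 < C ∧ ∀ t δ lam M : ℝ, 0 < t → 0 < δ → δ ≤ 1 →
    0 < lam → ∀ b : E2 → ℝ, IsSliceAmplitude t δ M b → ∀ h : E2,
    ‖∫ u, Complex.exp (Complex.I * ((lam * phaseDiff t h u : ℝ) : ℂ)) *
      ((b (u + h) * b u : ℝ) : ℂ)‖ ≤
      C * (M ^ 2 * δ ^ 2) * ((1 + lam * δ * ‖h‖) ^ 3)⁻¹ := by
  obtain ⟨c, hc, hvol⟩ := exists_volume_real_sliceSet_le
  obtain ⟨D, hD, hjD⟩ := exists_jetLE_inv_dirDeriv_phaseDiff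
  refine ⟨8 * (1 + 512 * D ^ 3) * c, by positivity,
    fun t δ lam M ht hδ hδ1 hlam b hb h => ?_⟩
  have hρ : 0 < δ * t := by positivity
  set κ := ‖h‖ / (δ * t) with hκdef
  have hκ : 0 ≤ κ := by positivity
  set A : E2 → ℝ := fun u => b (u + h) * b u with hA
  have hbh := contDiff_translate hb.contDiff h
  have hAs : ContDiff ℝ (⊤ : ℕ∞) A := hbh.mul hb.contDiff
  set S : Set E2 := sliceSet t δ ∩ (fun u => u + h) ⁻¹' sliceSet t δ with hS
  have hSc : IsClosed S :=
    (isClosed_sliceSet δ).inter ((isClosed_sliceSet δ).preimage (by fun_prop))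
  have hSA : ∀ u, u ∉ S → A u = 0 := by
    intro u hu
    by_cases h1 : u ∈ sliceSet t δ
    · have h2 : u + h ∉ sliceSet t δ := fun h2 => hu ⟨h1, h2⟩
      simp [hA, hb.support_subset _ h2]
    · simp [hA, hb.support_subset _ h1]
  have hSfin : volume S ≠ ∞ :=
    ne_top_of_le_ne_top (isCompact_sliceSet δ).measure_lt_top.ne
      (measure_mono Set.inter_subset_left)
  have hSvol : volume.real S ≤ c * (δ * t) ^ 2 :=
    (measureReal_mono Set.inter_subset_left (isCompact_sliceSet δ).measure_lt_top.ne).trans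
      (hvol t δ ht.le hδ.le)
  have hAc : HasCompactSupport A :=
    HasCompactSupport.of_support_subset_isCompact (isCompact_sliceSet (t := t) δ) fun u hu => by
      by_contra hcon
      exact hu (by simp [hA, hb.support_subset _ hcon])
  have hjA : ∀ u ∈ S, JetLE h κ 3 A (8 * (M / t) ^ 2) u := by
    intro u hu
    refine (JetLE.mul hκ hbh hb.contDiff ((jetLE_translate h).2 (hb.jetLE h _ hu.2))
      (hb.jetLE h _ hu.1)).mono hκ (le_of_eq ?_)
    ring
  have htriv : ‖∫ u, Complex.exp (Complex.I * ((lam * phaseDiff t h u : ℝ) : ℂ)) *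
      ((A u : ℝ) : ℂ)‖ ≤ c * (M ^ 2 * δ ^ 2) := by
    rw [← setIntegral_eq_integral_of_forall_compl_eq_zero (s := S) (fun u hu => by
      rw [hSA u hu]; simp)]
    refine (norm_setIntegral_le_of_norm_le_const (C := (M / t) ^ 2) hSfin.lt_top
      fun u hu => ?_).trans ?_
    · rw [norm_mul, mul_comm Complex.I, Complex.norm_exp_ofReal_mul_I, one_mul, Complex.norm_real,
        Real.norm_eq_abs, hA, abs_mul, sq]
      have h1 := (hb.jetLE h _ hu.2).abs_le
      have h2 := (hb.jetLE h _ hu.1)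
      exact mul_le_mul h1 h2.abs_le (abs_nonneg _) h2.nonneg
    · calc (M / t) ^ 2 * volume.real S ≤ (M / t) ^ 2 * (c * (δ * t) ^ 2) := by gcongr
        _ = _ := by field_simp
  have hosc : 0 < lam * δ * ‖h‖ →
      ‖∫ u, Complex.exp (Complex.I * ((lam * phaseDiff t h u : ℝ) : ℂ)) *
      ((A u : ℝ) : ℂ)‖ ≤ c * (M ^ 2 * δ ^ 2) * (512 * D ^ 3 * ((lam * δ * ‖h‖)⁻¹) ^ 3) := by
    intro hy
    have hh : 0 < ‖h‖ := by
      rcases (norm_nonneg h).eq_or_lt with h0 | h0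
      · rw [← h0] at hy; simp at hy
      · exact h0
    have hh0 : h ≠ 0 := norm_pos_iff.1 hh
    have hκt : ‖h‖ / t ≤ κ := by
      rw [hκdef]
      gcongr
      nlinarith
    refine (norm_integral_exp_mul_le hlam (contDiff_phaseDiff ht h)
      (fun x => (dirDeriv_phaseDiff_pos ht hh0 x).ne') hAs hAc hSc hSA hSfin hκ hjA
      (fun u hu => hjD t ht h u hh0 hu.1.1 hu.2.1 κ hκt)).trans ?_
    calc 64 * (8 * (M / t) ^ 2) * (D * t / ‖h‖ ^ 2 * κ / lam) ^ 3 * volume.real S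
        ≤ 64 * (8 * (M / t) ^ 2) * (D * t / ‖h‖ ^ 2 * κ / lam) ^ 3 * (c * (δ * t) ^ 2) := by
          gcongr
      _ = _ := by
          rw [hκdef]
          field_simp
          ring
  have := inv_cube_bound (C := 512 * D ^ 3) (by positivity) (by positivity) (by positivity)
    htriv hosc
  refine this.trans (le_of_eq ?_)
  ring

theorem exists_lintegral_inv_cube_le : ∃ c : ℝ, 0 < c ∧ ∀ a : ℝ, 0 < a →
    ∫⁻ h : E2, ENNReal.ofReal (((1 + a * ‖h‖) ^ 3)⁻¹) ≤ ENNReal.ofReal (c * (a ^ 2)⁻¹) := by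
  have h1 : Integrable fun h : E2 => ((1 + ‖h‖) ^ 3)⁻¹ := by
    have := integrable_one_add_norm (E := E2) (μ := volume) (r := 3) (by simp; norm_num)
    refine this.congr (Filter.Eventually.of_forall fun h => ?_)
    simp only
    rw [Real.rpow_neg (by positivity)]
    norm_cast
  have hnn : 0 ≤ ∫ h : E2, ((1 + ‖h‖) ^ 3)⁻¹ := integral_nonneg fun h => by positivity
  refine ⟨(∫ h : E2, ((1 + ‖h‖) ^ 3)⁻¹) + 1, by positivity, fun a ha => ?_⟩
  have h2 : ∀ h : E2, ((1 + a * ‖h‖) ^ 3)⁻¹ = ((1 + ‖a • h‖) ^ 3)⁻¹ := fun h => by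
    rw [norm_smul, Real.norm_of_nonneg ha.le]
  simp only [h2]
  rw [← ofReal_integral_eq_lintegral_ofReal (h1.comp_smul ha.ne')
    (Filter.Eventually.of_forall fun h => by positivity)]
  refine ENNReal.ofReal_le_ofReal ?_
  rw [Measure.integral_comp_smul volume (fun h : E2 => ((1 + ‖h‖) ^ 3)⁻¹) a]
  simp only [finrank_euclideanSpace, Fintype.card_fin, smul_eq_mul]
  rw [abs_of_nonneg (by positivity), mul_comm]
  gcongr
  linarith

/-- Convolution on the plane with an oscillating slice of the cone has norm `O(λ⁻¹)`, uniformly in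
the height of the slice and in the opening of the cone. -/
theorem exists_convBound_slice : ∃ C : ℝ, 0 < C ∧ ∀ t δ lam M : ℝ, 0 < t → 0 < δ → δ ≤ 1 →
    0 < lam → 0 < M → ∀ b : E2 → ℝ, IsSliceAmplitude t δ M b →
    ConvBound (fun u => Complex.exp (Complex.I * ((lam * sliceNorm t u : ℝ) : ℂ)) * (b u : ℂ))
      (C * M * lam⁻¹) := by
  obtain ⟨C, hC, hauto⟩ := exists_norm_autocorrelation_le
  obtain ⟨c, hc, hint⟩ := exists_lintegral_inv_cube_le
  refine ⟨1 + C * c, by positivity, fun t δ lam M ht hδ hδ1 hlam hM b hb => ?_⟩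
  have hcont : Continuous fun u : E2 =>
      Complex.exp (Complex.I * ((lam * sliceNorm t u : ℝ) : ℂ)) * (b u : ℂ) := by
    have h1 := (contDiff_sliceNorm ht).continuous
    have h2 := hb.contDiff.continuous
    fun_prop
  have hsupp : HasCompactSupport fun u : E2 =>
      Complex.exp (Complex.I * ((lam * sliceNorm t u : ℝ) : ℂ)) * (b u : ℂ) :=
    HasCompactSupport.of_support_subset_isCompact (isCompact_sliceSet (t := t) δ) fun u hu => by
      by_contra hcon
      exact hu (by simp [hb.support_subset _ hcon])
  refine convBound_of_autocorrelation hcont.measurable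
    (hcont.integrable_of_hasCompactSupport hsupp) (by positivity) ?_
  have heq : ∀ h u : E2, Complex.exp (Complex.I * ((lam * sliceNorm t (u + h) : ℝ) : ℂ)) *
      (b (u + h) : ℂ) * (starRingEnd ℂ)
        (Complex.exp (Complex.I * ((lam * sliceNorm t u : ℝ) : ℂ)) * (b u : ℂ)) =
      Complex.exp (Complex.I * ((lam * phaseDiff t h u : ℝ) : ℂ)) *
        ((b (u + h) * b u : ℝ) : ℂ) := by
    intro h u
    have : Complex.exp (Complex.I * ((lam * phaseDiff t h u : ℝ) : ℂ)) =
        Complex.exp (Complex.I * ((lam * sliceNorm t (u + h) : ℝ) : ℂ)) *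
          Complex.exp (-(Complex.I * ((lam * sliceNorm t u : ℝ) : ℂ))) := by
      rw [← Complex.exp_add]
      congr 1
      unfold phaseDiff
      push_cast
      ring
    rw [this, map_mul, ← Complex.exp_conj, map_mul, Complex.conj_I, Complex.conj_ofReal,
      Complex.conj_ofReal, neg_mul, Complex.ofReal_mul (b (u + h))]
    ring
  simp only [heq]
  calc ∫⁻ h, ‖∫ u, Complex.exp (Complex.I * ((lam * phaseDiff t h u : ℝ) : ℂ)) *
        ((b (u + h) * b u : ℝ) : ℂ)‖ₑ
      ≤ ∫⁻ h : E2, ENNReal.ofReal (C * (M ^ 2 * δ ^ 2)) *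
          ENNReal.ofReal (((1 + lam * δ * ‖h‖) ^ 3)⁻¹) := by
        refine lintegral_mono fun h => ?_
        rw [← ENNReal.ofReal_mul (by positivity), ← ofReal_norm]
        exact ENNReal.ofReal_le_ofReal (hauto t δ lam M ht hδ hδ1 hlam b hb h)
    _ ≤ ENNReal.ofReal (C * (M ^ 2 * δ ^ 2)) * ENNReal.ofReal (c * ((lam * δ) ^ 2)⁻¹) := by
        rw [lintegral_const_mul' _ _ ENNReal.ofReal_ne_top]
        gcongr
        exact hint _ (by positivity)
    _ = ENNReal.ofReal (C * c * (M * lam⁻¹) ^ 2) := by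
        rw [← ENNReal.ofReal_mul (by positivity)]
        congr 1
        field_simp
    _ ≤ ENNReal.ofReal ((1 + C * c) * M * lam⁻¹) ^ 2 := by
        rw [← ENNReal.ofReal_pow (by positivity), mul_assoc (1 + C * c), mul_pow (1 + C * c)]
        refine ENNReal.ofReal_le_ofReal ?_
        gcongr
        have : 0 < C * c := by positivity
        nlinarith

/-! ### Cut-offs adapted to a cap -/

theorem norm_direction {z : E3} (hz : z ≠ 0) : ‖direction z‖ = 1 := by
  rw [direction, norm_smul, norm_inv, norm_norm, inv_mul_cancel₀ (norm_ne_zero_iff.2 hz)]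

theorem direction_smul {c : ℝ} (hc : 0 < c) (z : E3) : direction (c • z) = direction z := by
  unfold direction
  rw [norm_smul, Real.norm_of_nonneg hc.le, smul_smul, mul_inv, mul_comm c⁻¹, mul_assoc,
    inv_mul_cancel₀ hc.ne', mul_one]

theorem contDiffAt_direction {z : E3} (hz : z ≠ 0) : ContDiffAt ℝ (⊤ : ℕ∞) direction z :=
  ((contDiffAt_norm ℝ hz).inv (norm_ne_zero_iff.2 hz)).smul contDiffAt_id

/-- Directional derivatives of the composition of `F` with an affine map. -/
theorem dirDeriv_iterate_comp_affine {E E' : Type*} [NormedAddCommGroup E] [NormedSpace ℝ E]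
    [NormedAddCommGroup E'] [NormedSpace ℝ E'] {F : E' → ℝ} {s : Set E'} (hs : IsOpen s)
    (hF : ContDiffOn ℝ (⊤ : ℕ∞) F s) (a : E') (L : E →L[ℝ] E') (h : E) (k : ℕ)
    (has : ∀ u, a + L u ∈ s) (u : E) :
    (dirDeriv h)^[k] (fun u => F (a + L u)) u = iteratedFDeriv ℝ k F (a + L u) fun _ => L h := by
  induction k generalizing u with
  | zero => simp
  | succ k ih =>
    rw [Function.iterate_succ_apply', funext ih, iteratedFDeriv_succ_apply_left]
    have hd : DifferentiableAt ℝ (iteratedFDeriv ℝ k F) (a + L u) :=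
      (hF.contDiffAt (hs.mem_nhds (has u))).differentiableAt_iteratedFDeriv
        (by exact_mod_cast WithTop.coe_lt_top _)
    have h1 : HasFDerivAt (fun u => a + L u) L u := L.hasFDerivAt.const_add a
    have h2 := hd.hasFDerivAt.comp u h1
    have h3 := h2.continuousMultilinear_apply_const fun _ : Fin k => L h
    unfold dirDeriv
    rw [show fderiv ℝ (fun u => (iteratedFDeriv ℝ k F (a + L u)) fun _ => L h) u = _ from h3.fderiv]
    rfl

section Cutoff

variable {B : ℕ → ℝ} {δ M : ℝ} {ω₀ : E3} {χ : E3 → ℝ} {Φ : (ℝ × E2) ≃L[ℝ] E3}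

theorem norm_axial_eq_sliceNorm (hΦ : ∀ p, ‖Φ p‖ ^ 2 = p.1 ^ 2 + ‖p.2‖ ^ 2) (t : ℝ) (u : E2) :
    ‖Φ (t, u)‖ = sliceNorm t u := by
  rw [sliceNorm, ← hΦ (t, u), Real.sqrt_sq (norm_nonneg _)]

/-- In axial coordinates, the cone over the cap lies over the sets `sliceSet t δ`. -/
theorem mem_sliceSet_of_dist_direction_le (hΦ : ∀ p, ‖Φ p‖ ^ 2 = p.1 ^ 2 + ‖p.2‖ ^ 2)
    (hΦ1 : Φ (1, 0) = ω₀) (hδ1 : δ ≤ 1) {t : ℝ} {u : E2}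
    (hz : Φ (t, u) ≠ 0) (hd : dist (direction (Φ (t, u))) ω₀ ≤ δ) :
    0 < t ∧ u ∈ sliceSet t δ := by
  have hr0 : 0 < ‖Φ (t, u)‖ := norm_pos_iff.2 hz
  set r := ‖Φ (t, u)‖ with hr
  have hδ0 : 0 ≤ δ := dist_nonneg.trans hd
  have hrsq : r ^ 2 = t ^ 2 + ‖u‖ ^ 2 := hΦ (t, u)
  have h1 : ‖Φ (t - r, u)‖ ≤ δ * r := by
    have h2 : Φ (t - r, u) = r • (direction (Φ (t, u)) - ω₀) := by
      rw [direction, ← hr, smul_sub, smul_smul, mul_inv_cancel₀ hr0.ne', one_smul, ← hΦ1,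
        ← map_smul, ← map_sub]
      simp
    rw [h2, norm_smul, Real.norm_of_nonneg hr0.le, mul_comm, ← dist_eq_norm]
    gcongr
  have h3 : (t - r) ^ 2 + ‖u‖ ^ 2 ≤ (δ * r) ^ 2 := by
    rw [← hΦ (t - r, u)]
    gcongr
  have hδr : (δ * r) ^ 2 ≤ r ^ 2 := by
    gcongr
    exact mul_le_of_le_one_left hr0.le hδ1
  have ht : r ≤ 2 * t := by nlinarith
  have hu : ‖u‖ ≤ δ * r := abs_le_of_sq_le_sq (by nlinarith [sq_nonneg (t - r)])
    (by positivity) |> (le_abs_self _).trans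
  refine ⟨by linarith, ?_, ?_⟩
  · rwa [← norm_axial_eq_sliceNorm hΦ]
  · calc ‖u‖ ≤ δ * r := hu
      _ ≤ δ * (2 * t) := by gcongr
      _ = _ := by ring

theorem axial_ne_zero (hΦ : ∀ p, ‖Φ p‖ ^ 2 = p.1 ^ 2 + ‖p.2‖ ^ 2) {t : ℝ} (ht : t ≠ 0) (u : E2) :
    Φ (t, u) ≠ 0 := by
  rw [← norm_pos_iff, norm_axial_eq_sliceNorm hΦ]
  unfold sliceNorm
  positivity

theorem IsCapCutoff.eq_zero (hχ : IsCapCutoff B δ ω₀ χ) {z : E3} (hz : z ≠ 0)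
    (hd : ¬ dist (direction z) ω₀ ≤ δ) : χ (direction z) = 0 := by
  by_contra hcon
  exact hd (hχ.support_subset _ (norm_direction hz) hcon)

theorem norm_iteratedFDeriv_le_of_isCapCutoff (hχ : IsCapCutoff B δ ω₀ χ) (hδ : 0 < δ)
    (hM : ∀ k ≤ 3, B k ≤ M) {k : ℕ} (hk : k ≤ 3) {ω : E3} (hω : ‖ω‖ = 1) :
    ‖iteratedFDeriv ℝ k (fun x => χ (direction x)) ω‖ ≤ M * (δ ^ k)⁻¹ :=
  (hχ.deriv_bound k ω hω).trans (by gcongr; exact hM k hk)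

theorem abs_cutoff_le (hχ : IsCapCutoff B δ ω₀ χ) (hδ : 0 < δ)
    (hM : ∀ k ≤ 3, B k ≤ M) {z : E3} (hz : z ≠ 0) : |χ (direction z)| ≤ M := by
  have h := norm_iteratedFDeriv_le_of_isCapCutoff hχ hδ hM (k := 0) (by norm_num)
    (norm_direction hz)
  have h2 : direction (direction z) = direction z := by
    conv_lhs => rw [direction, norm_direction hz, inv_one, one_smul]
  simpa [h2] using h

/-- By homogeneity, the derivatives of a cut-off at distance `r` from the origin are those of a
function varying at the scale `δ r`. -/
theorem jetLE_cutoff (hχ : IsCapCutoff B δ ω₀ χ) (hδ : 0 < δ) (hM : ∀ k ≤ 3, B k ≤ M)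
    (hΦ : ∀ p, ‖Φ p‖ ^ 2 = p.1 ^ 2 + ‖p.2‖ ^ 2) {t : ℝ} (ht : 0 < t) (h u : E2) :
    JetLE h (‖h‖ / (δ * t)) 3 (fun u => χ (direction (Φ (t, u)))) M u := by
  set r := sliceNorm t u with hr
  have hr0 : 0 < r := sliceNorm_pos ht u
  -- rescaling by `r⁻¹` moves the point to the unit sphere, where the derivatives are controlled
  set a : E3 := r⁻¹ • Φ (t, 0) with ha
  set L : E2 →L[ℝ] E3 := r⁻¹ • ((Φ : (ℝ × E2) →L[ℝ] E3).comp (ContinuousLinearMap.inr ℝ ℝ E2))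
    with hL
  have haL : ∀ v, a + L v = r⁻¹ • Φ (t, v) := fun v => by
    have : Φ (t, v) = Φ (t, 0) + Φ (0, v) := by rw [← map_add]; simp
    rw [this, smul_add]
    rfl
  have heq : (fun u => χ (direction (Φ (t, u)))) = fun u => χ (direction (a + L u)) := by
    ext v
    rw [haL, direction_smul (by positivity)]
  have hLh : ‖L h‖ = ‖h‖ / r := by
    have h1 : ‖Φ (0, h)‖ = ‖h‖ := by
      rw [norm_axial_eq_sliceNorm hΦ, sliceNorm]
      simp
    change ‖r⁻¹ • Φ (0, h)‖ = _
    rw [norm_smul, h1, Real.norm_of_nonneg (by positivity)]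
    field_simp
  have hunit : ‖a + L u‖ = 1 := by
    rw [haL, norm_smul, norm_axial_eq_sliceNorm hΦ, ← hr, Real.norm_of_nonneg (by positivity),
      inv_mul_cancel₀ hr0.ne']
  have hM0 : 0 ≤ M := (abs_nonneg _).trans (abs_cutoff_le hχ hδ hM
    (axial_ne_zero hΦ ht.ne' u))
  intro k hk
  rw [heq, dirDeriv_iterate_comp_affine (s := {0}ᶜ) (F := fun x => χ (direction x))
    isOpen_compl_singleton hχ.smooth a L h k (fun v => by
      rw [haL]
      simpa [hr0.ne'] using axial_ne_zero hΦ ht.ne' v)]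
  rw [← Real.norm_eq_abs]
  refine (ContinuousMultilinearMap.le_opNorm _ _).trans ?_
  rw [Finset.prod_const, Finset.card_univ, Fintype.card_fin, hLh]
  calc ‖iteratedFDeriv ℝ k (fun x => χ (direction x)) (a + L u)‖ * (‖h‖ / r) ^ k
      ≤ M * (δ ^ k)⁻¹ * (‖h‖ / t) ^ k := by
        gcongr
        · exact norm_iteratedFDeriv_le_of_isCapCutoff hχ hδ hM hk hunit
        · exact le_sliceNorm t u
    _ = _ := by
        rw [div_pow, div_pow, mul_pow]
        field_simp

/-- The slices of the kernel have amplitudes in the class treated by `exists_convBound_slice`. -/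
theorem exists_isSliceAmplitude : ∃ D : ℝ, 0 < D ∧ ∀ {B : ℕ → ℝ} {δ M : ℝ} {ω₀ : E3} {χ : E3 → ℝ}
    {Φ : (ℝ × E2) ≃L[ℝ] E3}, IsCapCutoff B δ ω₀ χ → 0 < δ → δ ≤ 1 → (∀ k ≤ 3, B k ≤ M) →
    (∀ p, ‖Φ p‖ ^ 2 = p.1 ^ 2 + ‖p.2‖ ^ 2) → Φ (1, 0) = ω₀ → ∀ {t : ℝ}, 0 < t →
    IsSliceAmplitude t δ (D * M) fun u => χ (direction (Φ (t, u))) * (sliceNorm t u)⁻¹ := by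
  obtain ⟨L, hL, hj⟩ := exists_jetLE_sliceNorm 3
  have hD := one_le_invJetConst hL 3
  refine ⟨8 * invJetConst L 3, by positivity, ?_⟩
  intro B δ M ω₀ χ Φ hχ hδ hδ1 hM hΦ hΦ1 t ht
  have hs := contDiff_sliceNorm ht
  have hne : ∀ x, sliceNorm t x ≠ 0 := fun x => (sliceNorm_pos ht x).ne'
  have hF : ContDiff ℝ (⊤ : ℕ∞) fun u => χ (direction (Φ (t, u))) := by
    rw [contDiff_iff_contDiffAt]
    intro u
    have h1 := hχ.smooth.contDiffAt (isOpen_compl_singleton.mem_nhds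
      (show Φ (t, u) ∈ ({0}ᶜ : Set E3) from axial_ne_zero hΦ ht.ne' u))
    have h2 : ContDiff ℝ (⊤ : ℕ∞) fun u : E2 => Φ (t, u) :=
      Φ.contDiff.comp (contDiff_const.prodMk contDiff_id)
    exact ContDiffAt.comp (g := fun x => χ (direction x)) (f := fun u : E2 => Φ (t, u)) u h1
      h2.contDiffAt
  refine ⟨hF.mul (hs.inv hne), fun u hu => ?_, fun h u hu => ?_⟩
  · rw [hχ.eq_zero (axial_ne_zero hΦ ht.ne' u), zero_mul]
    exact fun hd =>
      hu (mem_sliceSet_of_dist_direction_le hΦ hΦ1 hδ1 (axial_ne_zero hΦ ht.ne' u) hd).2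
  · have hκ : 0 ≤ ‖h‖ / (δ * t) := by positivity
    have hκ' : ‖h‖ / t ≤ ‖h‖ / (δ * t) := by
      gcongr
      exact mul_le_of_le_one_left ht.le hδ1
    have h1 := ((hj t ht h u hu.1).inv (by positivity) hs hne ht (le_sliceNorm t u)).mono_scale
      (by positivity) hκ'
    refine (JetLE.mul hκ hF (hs.inv hne) (jetLE_cutoff hχ hδ hM hΦ ht h u) h1).mono hκ
      (le_of_eq ?_)
    ring

/-! ### The operator with kernel `coneKernel` -/

theorem measurable_coneKernel (hχ : IsCapCutoff B δ ω₀ χ) (lam : ℝ) :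
    Measurable (coneKernel lam χ) := by
  refine measurable_of_continuousOn_compl_singleton 0 ?_
  unfold coneKernel
  refine ContinuousOn.mul (ContinuousOn.div (by fun_prop) (by fun_prop) fun z hz => ?_)
    (Complex.continuous_ofReal.comp_continuousOn hχ.smooth.continuousOn)
  simpa using hz

theorem norm_coneKernel_le (hχ : IsCapCutoff B δ ω₀ χ) (hδ : 0 < δ)
    (hM : ∀ k ≤ 3, B k ≤ M) (hM0 : 0 ≤ M) (lam : ℝ) (z : E3) :
    ‖coneKernel lam χ z‖ ≤ M * (1 + (‖z‖ ^ 2)⁻¹) := by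
  by_cases hz : z = 0
  · simp [coneKernel, hz, hM0]
  have hz0 : 0 < ‖z‖ := norm_pos_iff.2 hz
  rw [coneKernel, norm_mul, norm_div, mul_comm Complex.I, Complex.norm_exp_ofReal_mul_I,
    Complex.norm_real, Complex.norm_real, norm_norm, mul_comm]
  have h1 := abs_cutoff_le hχ hδ hM hz
  have h2 : 1 / ‖z‖ ≤ 1 + (‖z‖ ^ 2)⁻¹ := by
    rw [one_div, ← inv_pow]
    nlinarith [sq_nonneg (‖z‖⁻¹ - 1), sq_nonneg ‖z‖⁻¹, inv_pos.2 hz0]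
  rw [Real.norm_eq_abs]
  gcongr

theorem convBound_zero (N : ℝ) : ConvBound (fun _ => 0) N := fun f _ => by simp

theorem coneKernel_axial (hΦ : ∀ p, ‖Φ p‖ ^ 2 = p.1 ^ 2 + ‖p.2‖ ^ 2) (lam t : ℝ) (u : E2) :
    coneKernel lam χ (Φ (t, u)) = Complex.exp (Complex.I * ((lam * sliceNorm t u : ℝ) : ℂ)) *
      ((χ (direction (Φ (t, u))) * (sliceNorm t u)⁻¹ : ℝ) : ℂ) := by
  rw [coneKernel, norm_axial_eq_sliceNorm hΦ]
  push_cast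
  ring

theorem exists_convBound_coneKernel : ∃ C : ℝ, 0 < C ∧
    ∀ {B : ℕ → ℝ} {δ M lam : ℝ} {ω₀ : E3} {χ : E3 → ℝ}
    {Φ : (ℝ × E2) ≃L[ℝ] E3}, IsCapCutoff B δ ω₀ χ → 0 < δ → δ ≤ 1 → 0 < lam → 0 < M →
    (∀ k ≤ 3, B k ≤ M) → (∀ p, ‖Φ p‖ ^ 2 = p.1 ^ 2 + ‖p.2‖ ^ 2) → Φ (1, 0) = ω₀ →
    ∀ t : ℝ, t ≠ 0 → ConvBound (fun u => coneKernel lam χ (Φ (t, u))) (C * M * lam⁻¹) := by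
  obtain ⟨C, hC, hconv⟩ := exists_convBound_slice
  obtain ⟨D, hD, hamp⟩ := exists_isSliceAmplitude
  refine ⟨C * D, by positivity, ?_⟩
  intro B δ M lam ω₀ χ Φ hχ hδ hδ1 hlam hM0 hM hΦ hΦ1 t ht
  simp only [coneKernel_axial hΦ]
  rcases lt_or_gt_of_ne ht with ht | ht
  · have h0 : ∀ u, χ (direction (Φ (t, u))) = 0 := fun u =>
      hχ.eq_zero (axial_ne_zero hΦ ht.ne u) fun hd => by
        have := (mem_sliceSet_of_dist_direction_le hΦ hΦ1 hδ1 (axial_ne_zero hΦ ht.ne u) hd).1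
        linarith
    simp only [h0, zero_mul, Complex.ofReal_zero, mul_zero]
    exact convBound_zero _
  · rw [mul_assoc C D M]
    exact hconv t δ lam (D * M) ht hδ hδ1 hlam (by positivity) _ (hamp hχ hδ hδ1 hM hΦ hΦ1 ht)

theorem exists_hasL2OpNormLE_coneKernel {σ : ℝ} (hσ : 3 < σ) : ∃ C : ℝ, 0 < C ∧
    ∀ {B : ℕ → ℝ} {δ M lam : ℝ} {ω₀ : E3} {χ : E3 → ℝ},
    IsCapCutoff B δ ω₀ χ → 0 < δ → δ ≤ 1 → 0 < lam → 0 < M → (∀ k ≤ 3, B k ≤ M) →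
    HasL2OpNormLE (Qtilde σ lam χ) (C * M * lam⁻¹) := by
  obtain ⟨C, hC, hconv⟩ := exists_convBound_coneKernel
  have hI : 0 ≤ ∫ s, axialWeight σ s := integral_nonneg fun s => (axialWeight_pos σ s).le
  refine ⟨((∫ s, axialWeight σ s) + 1) * C, by positivity, ?_⟩
  intro B δ M lam ω₀ χ hχ hδ hδ1 hlam hM0 hM
  obtain ⟨Φ, hmp, hΦ, hΦ1⟩ := exists_axial_coordinates hχ.center_mem
  refine (hasL2OpNormLE_of_slices hσ hmp hΦ (measurable_coneKernel hχ lam)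
    (norm_coneKernel_le hχ hδ hM hM0.le lam) (N := C * M * lam⁻¹) (by positivity)
    (hconv hχ hδ hδ1 hlam hM0 hM hΦ hΦ1)).mono ?_
  have : 0 ≤ C * M * lam⁻¹ := by positivity
  nlinarith

end Cutoff

/-! ### The gradient of the kernel -/

/-- The cut-off multiplied by a coordinate of the direction. -/
def coordCutoff (χ : E3 → ℝ) (j : Fin 3) (ω : E3) : ℝ := χ ω * ω j

theorem exists_norm_iteratedFDeriv_direction_le (j : Fin 3) (k : ℕ) : ∃ c : ℝ, ∀ ω : E3, ‖ω‖ = 1 →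
    ‖iteratedFDerivWithin ℝ k (fun x => direction x j) {0}ᶜ ω‖ ≤ c := by
  have hsm : ContDiffOn ℝ (⊤ : ℕ∞) (fun x => direction x j) ({0}ᶜ : Set E3) := fun z hz =>
    (((EuclideanSpace.proj j : E3 →L[ℝ] ℝ).contDiff.contDiffAt).comp z
      (contDiffAt_direction hz)).contDiffWithinAt
  have hc := hsm.continuousOn_iteratedFDerivWithin (m := k)
    (by exact_mod_cast le_top) isOpen_compl_singleton.uniqueDiffOn
  obtain ⟨c, hc⟩ := (isCompact_sphere (0 : E3) 1).exists_bound_of_continuousOn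
    (hc.mono fun z hz => by
      rintro rfl
      simp at hz)
  exact ⟨c, fun ω hω => hc ω (by simpa using hω)⟩

/-- The components of the direction are smooth on the sphere, so multiplying a cut-off by one of
them only changes the sequence of constants. -/
theorem exists_isCapCutoff_coordCutoff (B : ℕ → ℝ) : ∃ B' : ℕ → ℝ,
    ∀ {δ : ℝ} {ω₀ : E3} {χ : E3 → ℝ}, 0 < δ → δ ≤ 1 → IsCapCutoff B δ ω₀ χ →
    ∀ j, IsCapCutoff B' δ ω₀ (coordCutoff χ j) := by
  choose c hc using exists_norm_iteratedFDeriv_direction_le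
  refine ⟨fun k => ∑ i ∈ Finset.range (k + 1),
    (k.choose i : ℝ) * |B i| * ∑ j, |c j (k - i)|, ?_⟩
  intro δ ω₀ χ hδ hδ1 hχ j
  have hsm : ContDiffOn ℝ (⊤ : ℕ∞) (fun x => direction x j) ({0}ᶜ : Set E3) := fun z hz =>
    (((EuclideanSpace.proj j : E3 →L[ℝ] ℝ).contDiff.contDiffAt).comp z
      (contDiffAt_direction hz)).contDiffWithinAt
  refine ⟨hχ.center_mem, hχ.smooth.mul hsm, fun ω hω h => hχ.support_subset ω hω ?_,
    fun k ω hω => ?_⟩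
  · intro h0
    exact h (by simp [coordCutoff, h0])
  · have hmem : ω ∈ ({0}ᶜ : Set E3) := by
      rintro rfl
      simp at hω
    have hop : IsOpen ({0}ᶜ : Set E3) := isOpen_compl_singleton
    change ‖iteratedFDeriv ℝ k (fun x => χ (direction x) * direction x j) ω‖ ≤ _
    rw [← iteratedFDerivWithin_of_isOpen k hop hmem]
    refine (norm_iteratedFDerivWithin_mul_le hχ.smooth hsm hop.uniqueDiffOn hmem
      (by exact_mod_cast le_top)).trans ?_
    rw [Finset.sum_mul]
    refine Finset.sum_le_sum fun i hi => ?_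
    have hik : i ≤ k := by simpa [Nat.lt_succ_iff] using hi
    have h1 : ‖iteratedFDerivWithin ℝ i (fun x => χ (direction x)) {0}ᶜ ω‖ ≤
        |B i| * (δ ^ k)⁻¹ := by
      rw [iteratedFDerivWithin_of_isOpen i hop hmem]
      refine (hχ.deriv_bound i ω hω).trans ?_
      have h2 : (δ ^ i)⁻¹ ≤ (δ ^ k)⁻¹ :=
        inv_anti₀ (by positivity) (pow_le_pow_of_le_one hδ.le hδ1 hik)
      gcongr
      exact le_abs_self _
    have h3 : ‖iteratedFDerivWithin ℝ (k - i) (fun x => direction x j) {0}ᶜ ω‖ ≤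
        ∑ j, |c j (k - i)| :=
      ((hc j (k - i) ω hω).trans (le_abs_self _)).trans
        (Finset.single_le_sum (f := fun j => |c j (k - i)|) (fun _ _ => abs_nonneg _)
          (Finset.mem_univ j))
    calc _ ≤ (k.choose i : ℝ) * (|B i| * (δ ^ k)⁻¹) * ∑ j, |c j (k - i)| := by gcongr
      _ = _ := by ring

section Gradient

variable {B : ℕ → ℝ} {δ M lam : ℝ} {ω₀ : E3} {χ : E3 → ℝ} {Φ : (ℝ × E2) ≃L[ℝ] E3}

/-- The amplitude of the kernel `coneKernel`. -/
noncomputable def coneAmplitude (χ : E3 → ℝ) (z : E3) : ℝ := χ (direction z) * ‖z‖⁻¹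

theorem coneKernel_eq (lam : ℝ) (χ : E3 → ℝ) (z : E3) : coneKernel lam χ z =
    Complex.exp (Complex.I * ((lam * ‖z‖ : ℝ) : ℂ)) * (coneAmplitude χ z : ℂ) := by
  rw [coneKernel, coneAmplitude]
  push_cast
  ring

theorem differentiableAt_cutoff (hχ : IsCapCutoff B δ ω₀ χ) {z : E3} (hz : z ≠ 0) :
    DifferentiableAt ℝ (fun z => χ (direction z)) z :=
  (hχ.smooth.contDiffAt (isOpen_compl_singleton.mem_nhds
    (show z ∈ ({0}ᶜ : Set E3) from hz))).differentiableAt (by simp)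

theorem differentiableAt_coneAmplitude (hχ : IsCapCutoff B δ ω₀ χ) {z : E3} (hz : z ≠ 0) :
    DifferentiableAt ℝ (coneAmplitude χ) z :=
  (differentiableAt_cutoff hχ hz).mul ((differentiableAt_id.norm ℝ hz).inv
    (norm_ne_zero_iff.2 hz))

theorem fderiv_norm_apply {z : E3} (hz : z ≠ 0) (v : E3) :
    fderiv ℝ (fun z : E3 => ‖z‖) z v = inner ℝ z v / ‖z‖ := by
  have hz0 : ‖z‖ ≠ 0 := norm_ne_zero_iff.2 hz
  have h1 := ((hasStrictFDerivAt_norm_sq z).hasFDerivAt).sqrt (by positivity)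
  simp only [Real.sqrt_sq (norm_nonneg _)] at h1
  rw [h1.fderiv]
  simp
  field_simp

theorem norm_fderiv_cutoff_le (hχ : IsCapCutoff B δ ω₀ χ) (hδ : 0 < δ) (hM : ∀ k ≤ 3, B k ≤ M)
    {z : E3} (hz : z ≠ 0) (v : E3) :
    |fderiv ℝ (fun z => χ (direction z)) z v| ≤ M * δ⁻¹ * (‖v‖ / ‖z‖) := by
  have hr : 0 < ‖z‖ := norm_pos_iff.2 hz
  have hunit : ‖(‖z‖⁻¹ • z)‖ = 1 := norm_direction hz
  have hne : ‖z‖⁻¹ • z ≠ 0 := by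
    intro h
    simp [h] at hunit
  have heq : (fun z => χ (direction z)) = fun x => χ (direction (‖z‖⁻¹ • x)) := by
    ext x
    rw [direction_smul (by positivity)]
  have h1 : HasFDerivAt (fun x : E3 => ‖z‖⁻¹ • x) (‖z‖⁻¹ • ContinuousLinearMap.id ℝ E3) z :=
    (‖z‖⁻¹ • ContinuousLinearMap.id ℝ E3).hasFDerivAt
  have h2 := (differentiableAt_cutoff hχ hne).hasFDerivAt.comp z h1
  have h3 := norm_iteratedFDeriv_le_of_isCapCutoff hχ hδ hM (k := 1) (by norm_num) hunit
  have h4 := ContinuousMultilinearMap.le_opNorm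
    (iteratedFDeriv ℝ 1 (fun x => χ (direction x)) (‖z‖⁻¹ • z)) fun _ => ‖z‖⁻¹ • v
  rw [iteratedFDeriv_one_apply] at h4
  have h5 : fderiv ℝ (fun z => χ (direction z)) z v =
      fderiv ℝ (fun z => χ (direction z)) (‖z‖⁻¹ • z) (‖z‖⁻¹ • v) := by
    conv_lhs => rw [heq]
    rw [show fderiv ℝ (fun x => χ (direction (‖z‖⁻¹ • x))) z = _ from h2.fderiv]
    simp
  rw [h5, ← Real.norm_eq_abs]
  refine h4.trans ?_
  rw [pow_one] at h3
  simp only [Finset.prod_const, Finset.card_univ, Fintype.card_fin, pow_one, norm_smul, norm_inv,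
    norm_norm]
  rw [show ‖z‖⁻¹ * ‖v‖ = ‖v‖ / ‖z‖ by field_simp]
  gcongr

theorem abs_fderiv_coneAmplitude_le (hχ : IsCapCutoff B δ ω₀ χ) (hδ : 0 < δ) (hδ1 : δ ≤ 1)
    (hM : ∀ k ≤ 3, B k ≤ M) (hM0 : 0 ≤ M) {z : E3} (hz : z ≠ 0) (v : E3) :
    |fderiv ℝ (coneAmplitude χ) z v| ≤ 2 * M * δ⁻¹ * ‖v‖ * (‖z‖ ^ 2)⁻¹ := by
  have hr : 0 < ‖z‖ := norm_pos_iff.2 hz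
  have hn : HasFDerivAt (fun z : E3 => ‖z‖) (fderiv ℝ (fun z : E3 => ‖z‖) z) z :=
    (differentiableAt_id.norm ℝ hz).hasFDerivAt
  have h1 := (hasDerivAt_inv hr.ne').comp_hasFDerivAt z hn
  have h2 := (differentiableAt_cutoff hχ hz).hasFDerivAt.mul h1
  have h3 : fderiv ℝ (coneAmplitude χ) z v = χ (direction z) *
      (-(‖z‖ ^ 2)⁻¹ * (inner ℝ z v / ‖z‖)) +
        ‖z‖⁻¹ * fderiv ℝ (fun z => χ (direction z)) z v := by
    rw [show fderiv ℝ (coneAmplitude χ) z = _ from h2.fderiv]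
    simp [fderiv_norm_apply hz]
  have h4 : |(inner ℝ z v / ‖z‖ : ℝ)| ≤ ‖v‖ := by
    rw [abs_div, abs_norm, div_le_iff₀ hr, mul_comm]
    exact abs_real_inner_le_norm z v
  have hδi : 1 ≤ δ⁻¹ := (one_le_inv₀ hδ).2 hδ1
  rw [h3]
  refine (abs_add_le _ _).trans ?_
  rw [abs_mul, abs_mul, abs_mul, abs_neg, abs_inv, abs_inv, abs_norm, abs_pow, abs_norm]
  calc |χ (direction z)| * ((‖z‖ ^ 2)⁻¹ * |(inner ℝ z v / ‖z‖ : ℝ)|) +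
        ‖z‖⁻¹ * |fderiv ℝ (fun z => χ (direction z)) z v|
      ≤ (M * δ⁻¹) * ((‖z‖ ^ 2)⁻¹ * ‖v‖) + ‖z‖⁻¹ * (M * δ⁻¹ * (‖v‖ / ‖z‖)) := by
        gcongr
        · exact (abs_cutoff_le hχ hδ hM hz).trans (le_mul_of_one_le_right hM0 hδi)
        · exact norm_fderiv_cutoff_le hχ hδ hM hz v
    _ = _ := by
        field_simp
        ring

/-- What remains of a partial derivative of the kernel after removal of the derivative of the
exponential. -/
noncomputable def gradRemainder (lam : ℝ) (χ : E3 → ℝ) (j : Fin 3) (z : E3) : ℂ :=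
  fderiv ℝ (coneKernel lam χ) z (EuclideanSpace.single j 1) -
    Complex.I * lam * coneKernel lam (coordCutoff χ j) z

theorem gradRemainder_eq (hχ : IsCapCutoff B δ ω₀ χ) (lam : ℝ) (j : Fin 3) {z : E3}
    (hz : z ≠ 0) : gradRemainder lam χ j z = Complex.exp (Complex.I * ((lam * ‖z‖ : ℝ) : ℂ)) *
      (fderiv ℝ (coneAmplitude χ) z (EuclideanSpace.single j 1) : ℂ) := by
  have hr : ‖z‖ ≠ 0 := norm_ne_zero_iff.2 hz
  have hn : HasFDerivAt (fun z : E3 => ‖z‖) (fderiv ℝ (fun z : E3 => ‖z‖) z) z :=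
    (differentiableAt_id.norm ℝ hz).hasFDerivAt
  have h1 := ((Complex.ofRealCLM.hasFDerivAt.comp z (hn.const_mul lam)).const_mul
    Complex.I).cexp
  have h2 := Complex.ofRealCLM.hasFDerivAt.comp z
    (differentiableAt_coneAmplitude hχ hz).hasFDerivAt
  have h3 := h1.mul h2
  have h4 := h3.congr_of_eventuallyEq (Filter.Eventually.of_forall (coneKernel_eq lam χ))
  have hzj : (inner ℝ z (EuclideanSpace.single j (1 : ℝ)) : ℝ) = z j := by
    simp [EuclideanSpace.inner_single_right]
  have hamp : coneAmplitude (coordCutoff χ j) z = coneAmplitude χ z * (z j / ‖z‖) := by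
    have : direction z j = ‖z‖⁻¹ * z j := rfl
    unfold coneAmplitude coordCutoff
    rw [this]
    ring
  rw [gradRemainder, h4.fderiv, coneKernel_eq, hamp]
  simp [fderiv_norm_apply hz, hzj]
  ring

theorem norm_gradRemainder_le (hχ : IsCapCutoff B δ ω₀ χ) (hδ : 0 < δ) (hδ1 : δ ≤ 1)
    (hM : ∀ k ≤ 3, B k ≤ M) (hM0 : 0 ≤ M) (lam : ℝ) (j : Fin 3) {z : E3} (hz : z ≠ 0) :
    ‖gradRemainder lam χ j z‖ ≤ 2 * M * δ⁻¹ * (‖z‖ ^ 2)⁻¹ := by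
  rw [gradRemainder_eq hχ lam j hz, norm_mul, mul_comm Complex.I, Complex.norm_exp_ofReal_mul_I,
    one_mul, Complex.norm_real, Real.norm_eq_abs]
  simpa using abs_fderiv_coneAmplitude_le hχ hδ hδ1 hM hM0 hz (EuclideanSpace.single j (1 : ℝ))

theorem gradRemainder_eq_zero (hχ : IsCapCutoff B δ ω₀ χ) (lam : ℝ) (j : Fin 3) {z : E3}
    (hz : z ≠ 0) (hd : ¬ dist (direction z) ω₀ ≤ δ) : gradRemainder lam χ j z = 0 := by
  have hev : coneAmplitude χ =ᶠ[nhds z] fun _ => 0 := by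
    have h1 : ∀ᶠ y in nhds z, δ < dist (direction y) ω₀ :=
      ((contDiffAt_direction hz).continuousAt.dist continuousAt_const).eventually
        (lt_mem_nhds (not_le.1 hd))
    filter_upwards [h1, isOpen_ne.mem_nhds hz] with y hy hy0
    simp [coneAmplitude, hχ.eq_zero hy0 (not_le.2 hy)]
  rw [gradRemainder_eq hχ lam j hz, hev.fderiv_eq]
  simp

theorem measurable_gradRemainder {B' : ℕ → ℝ} {j : Fin 3}
    (hχ' : IsCapCutoff B' δ ω₀ (coordCutoff χ j)) (lam : ℝ) :
    Measurable (gradRemainder lam χ j) :=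
  (measurable_fderiv_apply_const ℝ _ _).sub
    (measurable_const.mul (measurable_coneKernel hχ' lam))

/-- The slices of the remainder are bounded in `L¹`: the size `δ⁻¹ t⁻²` is compensated by the area
`δ² t²` of the slice. -/
theorem exists_convBound_gradRemainder : ∃ C : ℝ, 0 < C ∧
    ∀ {B B' : ℕ → ℝ} {δ M : ℝ} {ω₀ : E3} {χ : E3 → ℝ} {Φ : (ℝ × E2) ≃L[ℝ] E3} {j : Fin 3},
    IsCapCutoff B δ ω₀ χ → IsCapCutoff B' δ ω₀ (coordCutoff χ j) → 0 < δ → δ ≤ 1 → 0 < M →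
    (∀ k ≤ 3, B k ≤ M) → (∀ p, ‖Φ p‖ ^ 2 = p.1 ^ 2 + ‖p.2‖ ^ 2) → Φ (1, 0) = ω₀ →
    ∀ lam t : ℝ, t ≠ 0 → ConvBound (fun u => gradRemainder lam χ j (Φ (t, u))) (C * M) := by
  obtain ⟨c, hc, hvol⟩ := exists_volume_real_sliceSet_le
  refine ⟨2 * c, by positivity, ?_⟩
  intro B B' δ M ω₀ χ Φ j hχ hχ' hδ hδ1 hM0 hM hΦ hΦ1 lam t ht
  have hzero : ∀ u, ¬ (0 < t ∧ u ∈ sliceSet t δ) → gradRemainder lam χ j (Φ (t, u)) = 0 :=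
    fun u hu => gradRemainder_eq_zero hχ lam j (axial_ne_zero hΦ ht u) fun hd =>
      hu (mem_sliceSet_of_dist_direction_le hΦ hΦ1 hδ1 (axial_ne_zero hΦ ht u) hd)
  rcases lt_or_gt_of_ne ht with ht | ht
  · have : ∀ u, gradRemainder lam χ j (Φ (t, u)) = 0 := fun u =>
      hzero u fun h => by linarith [h.1]
    simp only [this]
    exact convBound_zero _
  · refine convBound_of_lintegral_le ((measurable_gradRemainder hχ' lam).comp
      (Φ.continuous.measurable.comp measurable_prodMk_left)) ?_
    have hS : MeasurableSet (sliceSet t δ) := (isClosed_sliceSet δ).measurableSet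
    have hSfin : volume (sliceSet t δ) ≠ ∞ := (isCompact_sliceSet δ).measure_lt_top.ne
    calc ∫⁻ u, ‖gradRemainder lam χ j (Φ (t, u))‖ₑ
        ≤ ∫⁻ u, (sliceSet t δ).indicator
            (fun _ => ENNReal.ofReal (2 * M * δ⁻¹ * (t ^ 2)⁻¹)) u := by
          refine lintegral_mono fun u => ?_
          by_cases hu : u ∈ sliceSet t δ
          · rw [Set.indicator_of_mem hu, ← ofReal_norm]
            refine ENNReal.ofReal_le_ofReal ((norm_gradRemainder_le hχ hδ hδ1 hM hM0.le lam j
              (axial_ne_zero hΦ ht.ne' u)).trans ?_)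
            rw [norm_axial_eq_sliceNorm hΦ]
            have := le_sliceNorm t u
            gcongr
          · simp [hzero u fun h => hu h.2]
      _ = ENNReal.ofReal (2 * M * δ⁻¹ * (t ^ 2)⁻¹) * volume (sliceSet t δ) := by
          rw [lintegral_indicator_const hS]
      _ = ENNReal.ofReal (2 * M * δ⁻¹ * (t ^ 2)⁻¹ * volume.real (sliceSet t δ)) := by
          rw [ENNReal.ofReal_mul (p := 2 * M * δ⁻¹ * (t ^ 2)⁻¹) (by positivity), Measure.real,
            ENNReal.ofReal_toReal hSfin]
      _ ≤ ENNReal.ofReal (2 * c * M) := by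
          refine ENNReal.ofReal_le_ofReal ?_
          calc 2 * M * δ⁻¹ * (t ^ 2)⁻¹ * volume.real (sliceSet t δ)
              ≤ 2 * M * δ⁻¹ * (t ^ 2)⁻¹ * (c * (δ * t) ^ 2) := by
                gcongr
                exact hvol t δ ht.le hδ.le
            _ = 2 * c * M * δ := by field_simp
            _ ≤ 2 * c * M := mul_le_of_le_one_right (by positivity) hδ1

theorem exists_hasL2OpNormLE_gradRemainder {σ : ℝ} (hσ : 3 < σ) : ∃ C : ℝ, 0 < C ∧
    ∀ {B B' : ℕ → ℝ} {δ M : ℝ} {ω₀ : E3} {χ : E3 → ℝ} {j : Fin 3},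
    IsCapCutoff B δ ω₀ χ → IsCapCutoff B' δ ω₀ (coordCutoff χ j) → 0 < δ → δ ≤ 1 → 0 < M →
    (∀ k ≤ 3, B k ≤ M) → ∀ lam : ℝ, HasL2OpNormLE
      (fun x y => (weight σ x : ℂ) * gradRemainder lam χ j (x - y) * (weight σ y : ℂ))
      (C * M) := by
  obtain ⟨C, hC, hconv⟩ := exists_convBound_gradRemainder
  have hI : 0 ≤ ∫ s, axialWeight σ s := integral_nonneg fun s => (axialWeight_pos σ s).le
  refine ⟨((∫ s, axialWeight σ s) + 1) * C, by positivity, ?_⟩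
  intro B B' δ M ω₀ χ j hχ hχ' hδ hδ1 hM0 hM lam
  obtain ⟨Φ, hmp, hΦ, hΦ1⟩ := exists_axial_coordinates hχ.center_mem
  -- at the origin `fderiv` takes an unspecified value, absorbed in the constant
  have hbd : ∀ z, ‖gradRemainder lam χ j z‖ ≤
      (2 * M * δ⁻¹ + ‖gradRemainder lam χ j 0‖) * (1 + (‖z‖ ^ 2)⁻¹) := by
    intro z
    have h0 : 0 ≤ 2 * M * δ⁻¹ := by positivity
    have h1 : 0 ≤ (‖z‖ ^ 2)⁻¹ := by positivity
    have h2 := norm_nonneg (gradRemainder lam χ j 0)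
    by_cases hz : z = 0
    · subst hz
      nlinarith
    · refine (norm_gradRemainder_le hχ hδ hδ1 hM hM0.le lam j hz).trans ?_
      nlinarith
  refine (hasL2OpNormLE_of_slices hσ hmp hΦ (measurable_gradRemainder hχ' lam) hbd
    (N := C * M) (by positivity) (hconv hχ hχ' hδ hδ1 hM0 hM hΦ hΦ1 lam)).mono ?_
  have : 0 ≤ C * M := by positivity
  nlinarith

theorem Qgrad_apply (σ lam : ℝ) (χ : E3 → ℝ) (x y : E3) (j : Fin 3) :
    Qgrad σ lam χ x y j = Complex.I * lam * Qtilde σ lam (coordCutoff χ j) x y +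
      (weight σ x : ℂ) * gradRemainder lam χ j (x - y) * (weight σ y : ℂ) := by
  have : Qgrad σ lam χ x y j = ((weight σ x * weight σ y : ℝ) : ℂ) *
      fderiv ℝ (fun x' => coneKernel lam χ (x' - y)) x (EuclideanSpace.single j 1) := rfl
  rw [this, fderiv_comp_sub, Qtilde, gradRemainder]
  push_cast
  ring

end Gradient

theorem exists_forall_le_of_le_three (B : ℕ → ℝ) : ∃ M : ℝ, 0 < M ∧ ∀ k ≤ 3, B k ≤ M := by
  refine ⟨1 + ∑ k ∈ Finset.range 4, |B k|, ?_, fun k hk => ?_⟩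
  · have : 0 ≤ ∑ k ∈ Finset.range 4, |B k| := Finset.sum_nonneg fun _ _ => abs_nonneg _
    linarith
  · have := Finset.single_le_sum (f := fun k => |B k|) (s := Finset.range 4)
      (fun _ _ => abs_nonneg _) (Finset.mem_range.2 (show k < 4 by omega))
    linarith [le_abs_self (B k)]

theorem proposition4p6 (σ : ℝ) (hσ : 4 < σ) (B : ℕ → ℝ) :
    ∃ C₀ : ℝ, 0 < C₀ ∧
      ∀ δ : ℝ, 0 < δ → δ ≤ 1 →
      ∀ lam : ℝ, (δ ^ 2)⁻¹ < lam →
      ∀ (ω₀ : E3) (χ : E3 → ℝ), IsCapCutoff B δ ω₀ χ →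
        HasL2OpNormLE (Qtilde σ lam χ) (C₀ * lam⁻¹) ∧
        HasL2OpNormLE (Qgrad σ lam χ) C₀ := by
  have hσ3 : 3 < σ := by linarith
  obtain ⟨C, hC, hK⟩ := exists_hasL2OpNormLE_coneKernel hσ3
  obtain ⟨C', hC', hR⟩ := exists_hasL2OpNormLE_gradRemainder hσ3
  obtain ⟨B', hB'⟩ := exists_isCapCutoff_coordCutoff B
  obtain ⟨M, hM0, hM⟩ := exists_forall_le_of_le_three B
  obtain ⟨M', hM'0, hM'⟩ := exists_forall_le_of_le_three B'
  refine ⟨C * M + 3 * (C * M' + C' * M), by positivity, ?_⟩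
  intro δ hδ hδ1 lam hlam ω₀ χ hχ
  have hlam0 : 0 < lam := lt_trans (by positivity) hlam
  refine ⟨(hK hχ hδ hδ1 hlam0 hM0 hM).mono ?_, ?_⟩
  · have : 0 ≤ 3 * (C * M' + C' * M) := by positivity
    gcongr
    linarith
  · refine (hasL2OpNormLE_of_components (C := C * M' + C' * M) fun j => ?_).mono ?_
    · have hχ' := hB' hδ hδ1 hχ j
      have h1 := (hK hχ' hδ hδ1 hlam0 hM'0 hM').const_mul (Complex.I * lam)
      have h2 := h1.add (hR hχ hχ' hδ hδ1 hM0 hM lam)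
      simp only [Qgrad_apply]
      refine h2.mono (le_of_eq ?_)
      rw [norm_mul, Complex.norm_I, Complex.norm_real, Real.norm_of_nonneg hlam0.le]
      field_simp
    · have : 0 ≤ C * M := by positivity
      linarith
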